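/- Let $\Phi$ be a unital commutative ring and $G$ an abelian group. Let $A=\bigoplus_{\sigma\in G}A_\sigma$ be a $G$-graded semiprime associative $\Phi$-algebra (not necessarily unital) without 2-torsion (that is, $2a=0$ implies $a=0$ for $a\in A$), with a $\Phi$-linear involution $*$ such that $A_\sigma^*=A_\sigma$ for every $\sigma\in G$. Let $Q_s(A)$ be the Martindale symmetric algebra of quotients of $A$, with the involution extending $*$, and let $Q=\bigoplus_{\sigma\in G}Q_\sigma$ be a $G$-graded algebra such that $Q$ is a subalgebra of $Q_s(A)$, $A\subseteq Q$ with $A_\sigma\subseteq Q_\sigma$, and $Q_\sigma^*=Q_\sigma$ for every $\sigma\in G$. For an algebra $R$ with involution, let $K_R=\{x\in R: x^*=-x\}$, a Lie algebra with bracket $[x,y]=xy-yx$; for a Lie algebra $L$ let $Z_L$ be its center and let $[L,L]$ be the linear span of its brackets. The Lie algebras $K_R/Z_{K_R}$ and $[K_R,K_R]/Z_{[K_R,K_R]}$, for $R=A$ and $R=Q$, are considered with the gradings induced by that of $R$. A $G$-graded Lie algebra $M=\bigoplus_\sigma M_\sigma$ is a *graded algebra of quotients* of a graded subalgebra $L=\bigoplus_\sigma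 L_\sigma$ if for all $\sigma,\tau\in G$, $0\neq p\in M_\sigma$ and $q\in M_\tau$ there are $\alpha\in G$ and $x\in L_\alpha$ such that $[x,p]\neq 0$ and $[x,{}_L(q)]\subseteq L$, where ${}_L(q)$ is the linear span in $M$ of $q$ and all elements $\operatorname{ad}_{x_1}\cdots\operatorname{ad}_{x_n}q$ with $n\ge 1$ and $x_1,\dots,x_n\in L$. Then: (i) the inclusion $K_A\subseteq K_Q$ induces an injective homomorphism of graded Lie algebras $K_A/Z_{K_A}\to K_Q/Z_{K_Q}$, and through it $K_Q/Z_{K_Q}$ is a graded algebra of quotients of $K_A/Z_{K_A}$; (ii) the inclusion $[K_A,K_A]\subseteq[K_Q,K_Q]$ induces an injective homomorphism of graded Lie algebras $[K_A,K_A]/Z_{[K_A,K_A]}\to[K_Q,K_Q]/Z_{[K_Q,K_Q]}$, and through it $[K_Q,K_Q]/Z_{[K_Q,K_Q]}$ is a graded algebra of quotients of $[K_A,K_A]/Z_{[K_A,K_A]}$. -/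

import Mathlib

/-! ### Graded algebras of quotients of graded Lie algebras -/

section GradedQuotients

variable {Φ L M G : Type*} [CommRing Φ] [LieRing L] [LieAlgebra Φ L] [LieRing M] [LieAlgebra Φ M]

/-- For a Lie homomorphism `φ : L → M` (the inclusion of `L` when `φ` is injective) and `q : M`,
the linear span of the elements `ad x₁ ⋯ ad xₙ q` with `n ≥ 0` and `x₁, …, xₙ` in `L`
(for `n = 0` this is `q` itself). -/
def adSpan (φ : L →ₗ⁅Φ⁆ M) (q : M) : Submodule Φ M :=
  Submodule.span Φ {y | ∃ l : List L, y = l.foldr (fun x z => ⁅φ x, z⁆) q}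

/-- The Lie algebra `M`, graded by `ℳ`, is a graded algebra of quotients of the Lie algebra `L`,
graded by `ℒ`, where `L` is regarded as a graded subalgebra of `M` through `φ`. -/
structure IsGradedAlgebraOfQuotients [AddCommGroup G] [DecidableEq G] (φ : L →ₗ⁅Φ⁆ M)
    (ℒ : G → Submodule Φ L) (ℳ : G → Submodule Φ M) : Prop where
  /-- `L` is a graded Lie algebra. -/
  isInternal_sub : DirectSum.IsInternal ℒ
  gradedBracket_sub : SetLike.GradedBracket ℒ
  /-- `M` is a graded Lie algebra. -/
  isInternal : DirectSum.IsInternal ℳ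
  gradedBracket : SetLike.GradedBracket ℳ
  /-- `φ` identifies `L` with a graded subalgebra of `M`. -/
  injective : Function.Injective φ
  map_mem : ∀ σ, ∀ x ∈ ℒ σ, φ x ∈ ℳ σ
  /-- For homogeneous `p ≠ 0` and `q` in `M` there is a homogeneous `x` in `L` with `[x, p] ≠ 0`
  and `[x, y] ∈ L` for all `y` in the span of the `ad x₁ ⋯ ad xₙ q`. -/
  absorb : ∀ σ τ, ∀ p ∈ ℳ σ, p ≠ 0 → ∀ q ∈ ℳ τ,
    ∃ α, ∃ x ∈ ℒ α, ⁅φ x, p⁆ ≠ 0 ∧ ∀ y ∈ adSpan φ q, ⁅φ x, y⁆ ∈ φ.range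

/-- The quotient `L / Z_L` of a Lie algebra by its center. -/
abbrev ModCenter (Φ L : Type*) [CommRing Φ] [LieRing L] [LieAlgebra Φ L] : Type _ :=
  L ⧸ LieAlgebra.center Φ L

/-- The projection `L → L / Z_L`. -/
def modCenter (Φ L : Type*) [CommRing Φ] [LieRing L] [LieAlgebra Φ L] :
    L →ₗ⁅Φ⁆ ModCenter Φ L where
  toLinearMap := (LieAlgebra.center Φ L).toSubmodule.mkQ
  map_lie' := rfl

/-- The family of submodules of `L / Z_L` induced by a family of submodules of `L`. -/
def modCenterGrading (ℒ : G → Submodule Φ L) (σ : G) : Submodule Φ (ModCenter Φ L) :=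
  (ℒ σ).map (modCenter Φ L : L →ₗ[Φ] ModCenter Φ L)

/-- The derived algebra `[L, L]` (the linear span of all brackets). -/
abbrev Derived (Φ L : Type*) [CommRing Φ] [LieRing L] [LieAlgebra Φ L] : LieIdeal Φ L :=
  ⁅(⊤ : LieIdeal Φ L), (⊤ : LieIdeal Φ L)⁆

theorem map_mem_Derived (f : L →ₗ⁅Φ⁆ M) (x : L) (hx : x ∈ Derived Φ L) : f x ∈ Derived Φ M :=
  (LieIdeal.map_bracket_le f).trans (LieSubmodule.mono_lie le_top le_top) (LieIdeal.mem_map hx)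

/-- The homomorphism `[L, L] → [M, M]` induced by a homomorphism `L → M`. -/
def derivedMap (f : L →ₗ⁅Φ⁆ M) : Derived Φ L →ₗ⁅Φ⁆ Derived Φ M where
  toFun x := ⟨f x, map_mem_Derived f x x.2⟩
  map_add' x y := Subtype.ext (map_add f (x : L) (y : L))
  map_smul' c x := Subtype.ext (map_smul f c (x : L))
  map_lie' {x y} := Subtype.ext (LieHom.map_lie f (x : L) (y : L))

/-- The family of submodules `[L, L] ∩ L_σ` of `[L, L]`. -/
def derivedGrading (ℒ : G → Submodule Φ L) (σ : G) : Submodule Φ (Derived Φ L) :=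
  (ℒ σ).comap (Derived Φ L).toSubmodule.subtype

end GradedQuotients

/-! ### Skew elements of an associative algebra with involution -/

section Skew

variable (Φ R : Type*) [CommRing Φ] [StarRing Φ] [TrivialStar Φ] [NonUnitalRing R] [StarRing R]
  [Module Φ R] [StarModule Φ R]

/-- `K_R = {x ∈ R | x* = -x}`. -/
abbrev Skew : Type _ := skewAdjoint.submodule Φ R

/-- The bracket of `K_R` is the commutator `[x, y] = xy - yx`. -/
instance Skew.instBracket : Bracket (Skew Φ R) (Skew Φ R) where
  bracket x y := ⟨(x : R) * y - y * x, by
    have hx : star (x : R) = -x := x.2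
    have hy : star (y : R) = -y := y.2
    change star ((x : R) * y - y * x) = -((x : R) * y - y * x)
    simp [hx, hy]⟩

instance Skew.instLieRing : LieRing (Skew Φ R) where
  add_lie x y z := Subtype.ext (by
    change ((x : R) + y) * z - z * (x + y) = (x * z - z * x) + (y * z - z * y)
    noncomm_ring)
  lie_add x y z := Subtype.ext (by
    change (x : R) * (y + z) - (y + z) * x = (x * y - y * x) + (x * z - z * x)
    noncomm_ring)
  lie_self x := Subtype.ext (sub_self _)
  leibniz_lie x y z := Subtype.ext (by
    change (x : R) * (y * z - z * y) - (y * z - z * y) * x =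
      ((x * y - y * x) * z - z * (x * y - y * x)) + (y * (x * z - z * x) - (x * z - z * x) * y)
    noncomm_ring)

instance Skew.instLieAlgebra [IsScalarTower Φ R R] [SMulCommClass Φ R R] :
    LieAlgebra Φ (Skew Φ R) where
  lie_smul c x y := Subtype.ext (by
    change (x : R) * (c • (y : R)) - (c • (y : R)) * x = c • ((x : R) * y - y * x)
    rw [mul_smul_comm, smul_mul_assoc, smul_sub])

variable {Φ R}

/-- The homomorphism `K_R → K_S` induced by a homomorphism of algebras with involution `R → S`. -/
def skewMap {S : Type*} [NonUnitalRing S] [StarRing S] [Module Φ S] [StarModule Φ S]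
    [IsScalarTower Φ R R] [SMulCommClass Φ R R] [IsScalarTower Φ S S] [SMulCommClass Φ S S]
    (f : R →⋆ₙₐ[Φ] S) : Skew Φ R →ₗ⁅Φ⁆ Skew Φ S where
  toFun x := ⟨f x, by
    have hx : star (x : R) = -x := x.2
    change star (f x) = -f x
    rw [← map_star, hx, map_neg]⟩
  map_add' x y := Subtype.ext (map_add f (x : R) y)
  map_smul' c x := Subtype.ext (map_smul f c (x : R))
  map_lie' {x y} := Subtype.ext (by
    change f ((x : R) * y - y * x) = f x * f y - f y * f x
    simp)

/-- The family of submodules `K_R ∩ R_σ` of `K_R`. -/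
def skewGrading {G : Type*} (ℛ : G → Submodule Φ R) (σ : G) : Submodule Φ (Skew Φ R) :=
  (ℛ σ).comap (skewAdjoint.submodule Φ R).subtype

end Skew

/-! ### The Martindale symmetric algebra of quotients -/

/-- A (not necessarily unital) ring `A` is semiprime if `aAa = 0` implies `a = 0`
(equivalently, `A` has no nonzero ideal with zero square). -/
class IsSemiprimeAlg (A : Type*) [NonUnitalRing A] : Prop where
  eq_zero : ∀ a : A, (∀ x : A, a * x * a = 0) → a = 0

namespace Martindale

variable {Φ A : Type*} [CommRing Φ] [NonUnitalRing A] [Module Φ A]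

/-- `J` is a two-sided ideal of the algebra `A` with zero annihilator. When `A` is semiprime these
are exactly the essential ideals. -/
structure IsDenseIdeal (J : Submodule Φ A) : Prop where
  mul_left : ∀ a, ∀ x ∈ J, a * x ∈ J
  mul_right : ∀ a, ∀ x ∈ J, x * a ∈ J
  left_ann : ∀ a : A, (∀ x ∈ J, a * x = 0) → a = 0
  right_ann : ∀ a : A, (∀ x ∈ J, x * a = 0) → a = 0

/-- The restrictions of `f` and `g` to `J` are, respectively, a homomorphism of right `A`-modules
`J → A` and a homomorphism of left `A`-modules `J → A`, and `x f(y) = g(x) y` for `x, y ∈ J`.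
The values of `f` and `g` outside `J` are irrelevant. -/
structure IsCompatiblePair (J : Submodule Φ A) (f g : A → A) : Prop where
  f_add : ∀ x ∈ J, ∀ y ∈ J, f (x + y) = f x + f y
  f_smul : ∀ c : Φ, ∀ x ∈ J, f (c • x) = c • f x
  f_mul : ∀ x ∈ J, ∀ a, f (x * a) = f x * a
  g_add : ∀ x ∈ J, ∀ y ∈ J, g (x + y) = g x + g y
  g_smul : ∀ c : Φ, ∀ x ∈ J, g (c • x) = c • g x
  g_mul : ∀ x ∈ J, ∀ a, g (a * x) = a * g x
  compat : ∀ x ∈ J, ∀ y ∈ J, x * f y = g x * y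

theorem IsDenseIdeal.inf {J J' : Submodule Φ A} (h : IsDenseIdeal J) (h' : IsDenseIdeal J') :
    IsDenseIdeal (J ⊓ J') where
  mul_left a x hx := ⟨h.mul_left a x hx.1, h'.mul_left a x hx.2⟩
  mul_right a x hx := ⟨h.mul_right a x hx.1, h'.mul_right a x hx.2⟩
  left_ann a ha := h.left_ann a fun x hx => h'.left_ann _ fun y hy => by
    rw [mul_assoc]; exact ha _ ⟨h.mul_right y x hx, h'.mul_left x y hy⟩
  right_ann a ha := h.right_ann a fun x hx => h'.right_ann _ fun y hy => by
    rw [← mul_assoc]; exact ha _ ⟨h.mul_left y x hx, h'.mul_right x y hy⟩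

theorem isDenseIdeal_top [IsSemiprimeAlg A] : IsDenseIdeal (⊤ : Submodule Φ A) where
  mul_left _ _ _ := trivial
  mul_right _ _ _ := trivial
  left_ann a ha := IsSemiprimeAlg.eq_zero a fun x => by rw [ha x trivial, zero_mul]
  right_ann a ha := IsSemiprimeAlg.eq_zero a fun x => by rw [mul_assoc, ha _ trivial, mul_zero]

theorem IsCompatiblePair.mono {J J' : Submodule Φ A} {f g : A → A} (h : IsCompatiblePair J f g)
    (hJ : J' ≤ J) : IsCompatiblePair J' f g where
  f_add x hx y hy := h.f_add x (hJ hx) y (hJ hy)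
  f_smul c x hx := h.f_smul c x (hJ hx)
  f_mul x hx := h.f_mul x (hJ hx)
  g_add x hx y hy := h.g_add x (hJ hx) y (hJ hy)
  g_smul c x hx := h.g_smul c x (hJ hx)
  g_mul x hx := h.g_mul x (hJ hx)
  compat x hx y hy := h.compat x (hJ hx) y (hJ hy)

theorem exists_dense [IsScalarTower Φ A A] [SMulCommClass Φ A A] {J I : Submodule Φ A}
    {f g : A → A} (hJ : IsDenseIdeal J) (h : IsCompatiblePair J f g) (hI : IsDenseIdeal I) :
    ∃ K : Submodule Φ A, IsDenseIdeal K ∧ K ≤ I ∧ K ≤ J ∧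
      (∀ x ∈ K, f x ∈ I) ∧ ∀ x ∈ K, g x ∈ I := by
  have f0 : f 0 = 0 := by simpa using h.f_smul 0 0 J.zero_mem
  have g0 : g 0 = 0 := by simpa using h.g_smul 0 0 J.zero_mem
  let K : Submodule Φ A :=
    { carrier := {x | (x ∈ I ∧ x ∈ J) ∧ (f x ∈ I ∧ g x ∈ I) ∧
        (∀ a, f (a * x) ∈ I) ∧ ∀ a, g (x * a) ∈ I}
      zero_mem' := by simp [f0, g0]
      add_mem' := by
        rintro x y ⟨⟨x1, x2⟩, ⟨x3, x4⟩, x5, x6⟩ ⟨⟨y1, y2⟩, ⟨y3, y4⟩, y5, y6⟩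
        refine ⟨⟨I.add_mem x1 y1, J.add_mem x2 y2⟩, ⟨?_, ?_⟩, fun a => ?_, fun a => ?_⟩
        · rw [h.f_add x x2 y y2]; exact I.add_mem x3 y3
        · rw [h.g_add x x2 y y2]; exact I.add_mem x4 y4
        · rw [mul_add, h.f_add _ (hJ.mul_left a x x2) _ (hJ.mul_left a y y2)]
          exact I.add_mem (x5 a) (y5 a)
        · rw [add_mul, h.g_add _ (hJ.mul_right a x x2) _ (hJ.mul_right a y y2)]
          exact I.add_mem (x6 a) (y6 a)
      smul_mem' := by
        rintro c x ⟨⟨x1, x2⟩, ⟨x3, x4⟩, x5, x6⟩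
        refine ⟨⟨I.smul_mem c x1, J.smul_mem c x2⟩, ⟨?_, ?_⟩, fun a => ?_, fun a => ?_⟩
        · rw [h.f_smul c x x2]; exact I.smul_mem c x3
        · rw [h.g_smul c x x2]; exact I.smul_mem c x4
        · rw [mul_smul_comm, h.f_smul c _ (hJ.mul_left a x x2)]; exact I.smul_mem c (x5 a)
        · rw [smul_mul_assoc, h.g_smul c _ (hJ.mul_right a x x2)]; exact I.smul_mem c (x6 a) }
  have key : ∀ i ∈ I, ∀ j ∈ J, ∀ i' ∈ I, i * j * i' ∈ K := by
    intro i hi j hj i' hi'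
    have hij : i * j ∈ J := hJ.mul_left i j hj
    refine ⟨⟨hI.mul_left _ _ hi', hJ.mul_right _ _ hij⟩, ⟨?_, ?_⟩, fun a => ?_, fun a => ?_⟩
    · rw [h.f_mul _ hij]; exact hI.mul_left _ _ hi'
    · rw [mul_assoc, h.g_mul _ (hJ.mul_right _ _ hj)]; exact hI.mul_right _ _ hi
    · rw [← mul_assoc, h.f_mul _ (hJ.mul_left _ _ hij)]; exact hI.mul_left _ _ hi'
    · rw [mul_assoc, mul_assoc, h.g_mul _ (hJ.mul_right _ _ hj)]; exact hI.mul_right _ _ hi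
  refine ⟨K, ⟨?_, ?_, ?_, ?_⟩, fun x hx => hx.1.1, fun x hx => hx.1.2, fun x hx => hx.2.1.1,
    fun x hx => hx.2.1.2⟩
  · rintro a x ⟨⟨x1, x2⟩, ⟨x3, x4⟩, x5, x6⟩
    refine ⟨⟨hI.mul_left _ _ x1, hJ.mul_left _ _ x2⟩, ⟨x5 a, ?_⟩, fun b => ?_, fun b => ?_⟩
    · rw [h.g_mul x x2]; exact hI.mul_left _ _ x4
    · rw [← mul_assoc]; exact x5 _
    · rw [mul_assoc, h.g_mul _ (hJ.mul_right _ _ x2)]; exact hI.mul_left _ _ (x6 b)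
  · rintro a x ⟨⟨x1, x2⟩, ⟨x3, x4⟩, x5, x6⟩
    refine ⟨⟨hI.mul_right _ _ x1, hJ.mul_right _ _ x2⟩, ⟨?_, x6 a⟩, fun b => ?_, fun b => ?_⟩
    · rw [h.f_mul x x2]; exact hI.mul_right _ _ x3
    · rw [← mul_assoc, h.f_mul _ (hJ.mul_left _ _ x2)]; exact hI.mul_right _ _ (x5 b)
    · rw [mul_assoc]; exact x6 _
  · intro a ha
    refine hI.left_ann a fun i hi => hJ.left_ann _ fun j hj => hI.left_ann _ fun i' hi' => ?_
    have := ha _ (key i hi j hj i' hi')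
    simpa [mul_assoc] using this
  · intro a ha
    refine hI.right_ann a fun i hi => hJ.right_ann _ fun j hj => hI.right_ann _ fun i' hi' => ?_
    have := ha _ (key i' hi' j hj i hi)
    simpa [mul_assoc] using this

theorem IsDenseIdeal.exists_star [StarRing Φ] [TrivialStar Φ] [StarRing A] [StarModule Φ A]
    {J : Submodule Φ A} (h : IsDenseIdeal J) :
    ∃ K : Submodule Φ A, IsDenseIdeal K ∧ ∀ x, x ∈ K ↔ star x ∈ J := by
  let K : Submodule Φ A :=
    { carrier := {x | star x ∈ J}
      zero_mem' := by simp
      add_mem' := by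
        intro x y hx hy
        simpa using J.add_mem hx hy
      smul_mem' := by
        intro c x hx
        simpa using J.smul_mem c hx }
  have hK : ∀ x, x ∈ K ↔ star x ∈ J := fun x => Iff.rfl
  refine ⟨K, ⟨fun a x hx => ?_, fun a x hx => ?_, fun a ha => ?_, fun a ha => ?_⟩, hK⟩
  · rw [hK, star_mul]; exact h.mul_right _ _ hx
  · rw [hK, star_mul]; exact h.mul_left _ _ hx
  · refine star_eq_zero.1 (h.right_ann _ fun x hx => ?_)
    have := ha (star x) (by rw [hK, star_star]; exact hx)
    simpa using congrArg star this
  · refine star_eq_zero.1 (h.left_ann _ fun x hx => ?_)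
    have := ha (star x) (by rw [hK, star_star]; exact hx)
    simpa using congrArg star this

theorem isCompatiblePair_comp {J I K : Submodule Φ A} {f g f' g' : A → A}
    (h : IsCompatiblePair J f g) (h' : IsCompatiblePair I f' g') (hKJ : K ≤ J) (hKI : K ≤ I)
    (hf : ∀ x ∈ K, f' x ∈ J) (hg : ∀ x ∈ K, g x ∈ I) :
    IsCompatiblePair K (fun x => f (f' x)) (fun x => g' (g x)) where
  f_add x hx y hy := by rw [h'.f_add x (hKI hx) y (hKI hy), h.f_add _ (hf x hx) _ (hf y hy)]
  f_smul c x hx := by rw [h'.f_smul c x (hKI hx), h.f_smul c _ (hf x hx)]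
  f_mul x hx a := by rw [h'.f_mul x (hKI hx), h.f_mul _ (hf x hx)]
  g_add x hx y hy := by rw [h.g_add x (hKJ hx) y (hKJ hy), h'.g_add _ (hg x hx) _ (hg y hy)]
  g_smul c x hx := by rw [h.g_smul c x (hKJ hx), h'.g_smul c _ (hg x hx)]
  g_mul x hx a := by rw [h.g_mul x (hKJ hx), h'.g_mul _ (hg x hx)]
  compat x hx y hy := by
    rw [h.compat x (hKJ hx) _ (hf y hy), h'.compat _ (hg x hx) y (hKI hy)]

variable (Φ A) [IsScalarTower Φ A A] [SMulCommClass Φ A A] [IsSemiprimeAlg A]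

/-- The pairs `(f, g)` that are compatible on some dense ideal. -/
def pairs : Submodule Φ ((A → A) × (A → A)) where
  carrier := {p | ∃ J : Submodule Φ A, IsDenseIdeal J ∧ IsCompatiblePair J p.1 p.2}
  zero_mem' := ⟨⊤, isDenseIdeal_top, by constructor <;> simp⟩
  add_mem' := by
    rintro p q ⟨J, hJ, hp⟩ ⟨I, hI, hq⟩
    refine ⟨J ⊓ I, hJ.inf hI, ?_⟩
    have hp := hp.mono (inf_le_left : J ⊓ I ≤ J)
    have hq := hq.mono (inf_le_right : J ⊓ I ≤ I)
    constructor
    · intro x hx y hy; simp [hp.f_add x hx y hy, hq.f_add x hx y hy]; abel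
    · intro c x hx; simp [hp.f_smul c x hx, hq.f_smul c x hx]
    · intro x hx a; simp [hp.f_mul x hx, hq.f_mul x hx, add_mul]
    · intro x hx y hy; simp [hp.g_add x hx y hy, hq.g_add x hx y hy]; abel
    · intro c x hx; simp [hp.g_smul c x hx, hq.g_smul c x hx]
    · intro x hx a; simp [hp.g_mul x hx, hq.g_mul x hx, mul_add]
    · intro x hx y hy; simp [mul_add, add_mul, hp.compat x hx y hy, hq.compat x hx y hy]
  smul_mem' := by
    rintro c p ⟨J, hJ, hp⟩
    refine ⟨J, hJ, ?_⟩
    constructor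
    · intro x hx y hy; simp [hp.f_add x hx y hy]
    · intro d x hx; simp [hp.f_smul d x hx, smul_comm c d]
    · intro x hx a; simp [hp.f_mul x hx, smul_mul_assoc]
    · intro x hx y hy; simp [hp.g_add x hx y hy]
    · intro d x hx; simp [hp.g_smul d x hx, smul_comm c d]
    · intro x hx a; simp [hp.g_mul x hx, mul_smul_comm]
    · intro x hx y hy; simp [hp.compat x hx y hy, mul_smul_comm, smul_mul_assoc]

/-- The pairs `(f, g)` that vanish on some dense ideal. -/
def nullPairs : Submodule Φ (pairs Φ A) where
  carrier := {p | ∃ J : Submodule Φ A, IsDenseIdeal J ∧ ∀ x ∈ J, p.1.1 x = 0 ∧ p.1.2 x = 0}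
  zero_mem' := ⟨⊤, isDenseIdeal_top, by simp⟩
  add_mem' := by
    rintro p q ⟨J, hJ, hp⟩ ⟨I, hI, hq⟩
    exact ⟨J ⊓ I, hJ.inf hI, fun x hx => by simp [hp x hx.1, hq x hx.2]⟩
  smul_mem' := by
    rintro c p ⟨J, hJ, hp⟩
    exact ⟨J, hJ, fun x hx => by simp [hp x hx]⟩

/-- The Martindale symmetric algebra of quotients `Q_s(A)` of a semiprime algebra `A`: classes of
compatible pairs `(f, g)` defined on dense (that is, essential) ideals, two pairs being identified
when they agree on some dense ideal. The class of `(f, g)` is the element `q` with `q x = f(x)` and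
`x q = g(x)` for `x` in that ideal. -/
def Qs : Type _ := pairs Φ A ⧸ nullPairs Φ A

namespace Qs

instance : AddCommGroup (Qs Φ A) := inferInstanceAs (AddCommGroup (pairs Φ A ⧸ nullPairs Φ A))

instance : Module Φ (Qs Φ A) := inferInstanceAs (Module Φ (pairs Φ A ⧸ nullPairs Φ A))

variable {Φ A}

/-- The class of a pair. -/
def mk : pairs Φ A →ₗ[Φ] Qs Φ A := (nullPairs Φ A).mkQ

theorem mk_surjective : Function.Surjective (mk : pairs Φ A →ₗ[Φ] Qs Φ A) :=
  (nullPairs Φ A).mkQ_surjective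

theorem mk_eq_mk {p q : pairs Φ A} :
    mk p = mk q ↔ ∃ J : Submodule Φ A, IsDenseIdeal J ∧
      ∀ x ∈ J, p.1.1 x = q.1.1 x ∧ p.1.2 x = q.1.2 x := by
  refine (Submodule.Quotient.eq (nullPairs Φ A)).trans ?_
  refine exists_congr fun J => and_congr_right fun _ => forall₂_congr fun x _ => ?_
  exact and_congr sub_eq_zero sub_eq_zero

/-- Product of pairs: `(f, g)(f', g') = (f ∘ f', g' ∘ g)`. -/
def mulPair (p q : pairs Φ A) : pairs Φ A :=
  ⟨(fun x => p.1.1 (q.1.1 x), fun x => q.1.2 (p.1.2 x)), by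
    obtain ⟨J, hJ, hp⟩ := p.2
    obtain ⟨I, hI, hq⟩ := q.2
    obtain ⟨K, hK, hKI, hKJ, -, hgK⟩ := exists_dense hJ hp hI
    obtain ⟨K', hK', hKJ', hKI', hfK', -⟩ := exists_dense hI hq hJ
    exact ⟨K ⊓ K', hK.inf hK', isCompatiblePair_comp (f := p.1.1) (g' := q.1.2) hp hq (inf_le_left.trans hKJ)
      (inf_le_left.trans hKI) (fun x hx => hfK' x hx.2) fun x hx => hgK x hx.1⟩⟩

theorem mulPair_congr {p p' q q' : pairs Φ A} (hp : mk p = mk p') (hq : mk q = mk q') :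
    mk (mulPair p q) = mk (mulPair p' q') := by
  obtain ⟨J, hJ, hp⟩ := mk_eq_mk.1 hp
  obtain ⟨I, hI, hq⟩ := mk_eq_mk.1 hq
  obtain ⟨J₁, hJ₁, h₁⟩ := p.2
  obtain ⟨I₁, hI₁, h₂⟩ := q.2
  obtain ⟨K, hK, hKI, hKJ, -, hgK⟩ := exists_dense hJ₁ h₁ hI
  obtain ⟨K', hK', hKJ', hKI', hfK', -⟩ := exists_dense hI₁ h₂ hJ
  refine mk_eq_mk.2 ⟨K ⊓ K', hK.inf hK', fun x hx => ⟨?_, ?_⟩⟩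
  · change p.1.1 (q.1.1 x) = p'.1.1 (q'.1.1 x)
    rw [← (hq x (hKI hx.1)).1, (hp _ (hfK' x hx.2)).1]
  · change q.1.2 (p.1.2 x) = q'.1.2 (p'.1.2 x)
    rw [← (hp x (hKJ' hx.2)).2, (hq _ (hgK x hx.1)).2]

instance : Mul (Qs Φ A) where
  mul := Quotient.map₂ mulPair fun _ _ hp _ _ hq =>
    Quotient.exact (mulPair_congr (Quotient.sound hp) (Quotient.sound hq))

theorem mk_mul_mk (p q : pairs Φ A) : mk p * mk q = mk (mulPair p q) := rfl

instance : NonUnitalRing (Qs Φ A) where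
  left_distrib := by
    intro a b c
    obtain ⟨p, rfl⟩ := mk_surjective a
    obtain ⟨q, rfl⟩ := mk_surjective b
    obtain ⟨r, rfl⟩ := mk_surjective c
    rw [← map_add, mk_mul_mk, mk_mul_mk, mk_mul_mk, ← map_add, mk_eq_mk]
    obtain ⟨J, hJ, hp⟩ := p.2
    obtain ⟨I, hI, hq⟩ := q.2
    obtain ⟨I', hI', hr⟩ := r.2
    obtain ⟨K, hK, -, -, hf, -⟩ := exists_dense hI hq hJ
    obtain ⟨K', hK', -, -, hf', -⟩ := exists_dense hI' hr hJ
    exact ⟨K ⊓ K', hK.inf hK', fun x hx => ⟨hp.f_add _ (hf x hx.1) _ (hf' x hx.2), rfl⟩⟩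
  right_distrib := by
    intro a b c
    obtain ⟨p, rfl⟩ := mk_surjective a
    obtain ⟨q, rfl⟩ := mk_surjective b
    obtain ⟨r, rfl⟩ := mk_surjective c
    rw [← map_add, mk_mul_mk, mk_mul_mk, mk_mul_mk, ← map_add, mk_eq_mk]
    obtain ⟨J, hJ, hp⟩ := p.2
    obtain ⟨I, hI, hq⟩ := q.2
    obtain ⟨I', hI', hr⟩ := r.2
    obtain ⟨K, hK, -, -, -, hg⟩ := exists_dense hJ hp hI'
    obtain ⟨K', hK', -, -, -, hg'⟩ := exists_dense hI hq hI'
    exact ⟨K ⊓ K', hK.inf hK', fun x hx => ⟨rfl, hr.g_add _ (hg x hx.1) _ (hg' x hx.2)⟩⟩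
  zero_mul := by
    intro a
    obtain ⟨p, rfl⟩ := mk_surjective a
    rw [← map_zero mk, mk_mul_mk, mk_eq_mk]
    obtain ⟨J, hJ, hp⟩ := p.2
    have h0 : p.1.2 0 = 0 := by simpa using hp.g_smul 0 0 J.zero_mem
    exact ⟨⊤, isDenseIdeal_top, fun x _ => ⟨rfl, h0⟩⟩
  mul_zero := by
    intro a
    obtain ⟨p, rfl⟩ := mk_surjective a
    rw [← map_zero mk, mk_mul_mk, mk_eq_mk]
    obtain ⟨J, hJ, hp⟩ := p.2
    have h0 : p.1.1 0 = 0 := by simpa using hp.f_smul 0 0 J.zero_mem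
    exact ⟨⊤, isDenseIdeal_top, fun x _ => ⟨h0, rfl⟩⟩
  mul_assoc := by
    intro a b c
    obtain ⟨p, rfl⟩ := mk_surjective a
    obtain ⟨q, rfl⟩ := mk_surjective b
    obtain ⟨r, rfl⟩ := mk_surjective c
    rfl

instance : IsScalarTower Φ (Qs Φ A) (Qs Φ A) where
  smul_assoc := by
    intro c a b
    obtain ⟨p, rfl⟩ := mk_surjective a
    obtain ⟨q, rfl⟩ := mk_surjective b
    rw [smul_eq_mul, smul_eq_mul, ← map_smul, mk_mul_mk, mk_mul_mk, ← map_smul, mk_eq_mk]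
    obtain ⟨J, hJ, hp⟩ := p.2
    obtain ⟨I, hI, hq⟩ := q.2
    obtain ⟨K, hK, -, -, -, hg⟩ := exists_dense hJ hp hI
    exact ⟨K, hK, fun x hx => ⟨rfl, hq.g_smul c _ (hg x hx)⟩⟩

instance : SMulCommClass Φ (Qs Φ A) (Qs Φ A) where
  smul_comm := by
    intro c a b
    obtain ⟨p, rfl⟩ := mk_surjective a
    obtain ⟨q, rfl⟩ := mk_surjective b
    rw [smul_eq_mul, smul_eq_mul, ← map_smul, mk_mul_mk, mk_mul_mk, ← map_smul, mk_eq_mk]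
    obtain ⟨J, hJ, hp⟩ := p.2
    obtain ⟨I, hI, hq⟩ := q.2
    obtain ⟨K, hK, -, -, hf, -⟩ := exists_dense hI hq hJ
    exact ⟨K, hK, fun x hx => ⟨(hp.f_smul c _ (hf x hx)).symm, rfl⟩⟩

section Star

variable [StarRing Φ] [TrivialStar Φ] [StarRing A] [StarModule Φ A]

/-- The involution on pairs: since `q* x = (x* q)*` and `x q* = (q x*)*`, it sends `(f, g)` to
`(x ↦ g(x*)*, x ↦ f(x*)*)`. -/
def starPair (p : pairs Φ A) : pairs Φ A :=
  ⟨(fun x => star (p.1.2 (star x)), fun x => star (p.1.1 (star x))), by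
    obtain ⟨J, hJ, hp⟩ := p.2
    obtain ⟨K, hK, h⟩ := hJ.exists_star
    refine ⟨K, hK, ?_⟩
    constructor
    · intro x hx y hy; simp [hp.g_add _ ((h x).1 hx) _ ((h y).1 hy)]
    · intro c x hx; simp [hp.g_smul c _ ((h x).1 hx)]
    · intro x hx a; simp [hp.g_mul _ ((h x).1 hx)]
    · intro x hx y hy; simp [hp.f_add _ ((h x).1 hx) _ ((h y).1 hy)]
    · intro c x hx; simp [hp.f_smul c _ ((h x).1 hx)]
    · intro x hx a; simp [hp.f_mul _ ((h x).1 hx)]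
    · intro x hx y hy
      have := congrArg star (hp.compat _ ((h y).1 hy) _ ((h x).1 hx))
      simpa using this.symm⟩

theorem starPair_congr {p p' : pairs Φ A} (hp : mk p = mk p') :
    mk (starPair p) = mk (starPair p') := by
  obtain ⟨J, hJ, hp⟩ := mk_eq_mk.1 hp
  obtain ⟨K, hK, h⟩ := hJ.exists_star
  exact mk_eq_mk.2 ⟨K, hK, fun x hx => ⟨congrArg star (hp _ ((h x).1 hx)).2,
    congrArg star (hp _ ((h x).1 hx)).1⟩⟩

instance : Star (Qs Φ A) where
  star := Quotient.map starPair fun _ _ hp => Quotient.exact (starPair_congr (Quotient.sound hp))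

theorem star_mk (p : pairs Φ A) : star (mk p) = mk (starPair p) := rfl

instance : StarRing (Qs Φ A) where
  star_involutive := by
    intro a
    obtain ⟨p, rfl⟩ := mk_surjective a
    rw [star_mk, star_mk, mk_eq_mk]
    exact ⟨⊤, isDenseIdeal_top, fun x _ => by simp [starPair]⟩
  star_mul := by
    intro a b
    obtain ⟨p, rfl⟩ := mk_surjective a
    obtain ⟨q, rfl⟩ := mk_surjective b
    rw [star_mk, star_mk, mk_mul_mk, mk_mul_mk, star_mk, mk_eq_mk]
    exact ⟨⊤, isDenseIdeal_top, fun x _ => by simp [starPair, mulPair]⟩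
  star_add := by
    intro a b
    obtain ⟨p, rfl⟩ := mk_surjective a
    obtain ⟨q, rfl⟩ := mk_surjective b
    rw [star_mk, star_mk, ← map_add, ← map_add, star_mk, mk_eq_mk]
    exact ⟨⊤, isDenseIdeal_top, fun x _ => by simp [starPair]⟩

instance : StarModule Φ (Qs Φ A) where
  star_smul := by
    intro c a
    obtain ⟨p, rfl⟩ := mk_surjective a
    rw [star_trivial c, star_mk, ← map_smul, ← map_smul, star_mk, mk_eq_mk]
    exact ⟨⊤, isDenseIdeal_top, fun x _ => by simp [starPair]⟩

/-- The pair `(x ↦ a x, x ↦ x a)`. -/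
def multPair (a : A) : pairs Φ A :=
  ⟨(fun x => a * x, fun x => x * a), ⊤, isDenseIdeal_top, by
    constructor <;> simp [mul_add, add_mul, mul_assoc, mul_smul_comm, smul_mul_assoc]⟩

variable (Φ A) in
/-- The canonical embedding `A → Q_s(A)`. -/
def incl : A →⋆ₙₐ[Φ] Qs Φ A where
  toFun a := mk (multPair a)
  map_smul' c a := by
    rw [MonoidHom.id_apply, ← map_smul, mk_eq_mk]
    exact ⟨⊤, isDenseIdeal_top, fun x _ => by simp [multPair, mul_smul_comm, smul_mul_assoc]⟩
  map_zero' := by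
    rw [← map_zero mk, mk_eq_mk]
    exact ⟨⊤, isDenseIdeal_top, fun x _ => by simp [multPair]⟩
  map_add' a b := by
    rw [← map_add, mk_eq_mk]
    exact ⟨⊤, isDenseIdeal_top, fun x _ => by simp [multPair, add_mul, mul_add]⟩
  map_mul' a b := by
    rw [mk_mul_mk, mk_eq_mk]
    exact ⟨⊤, isDenseIdeal_top, fun x _ => by simp [multPair, mulPair, mul_assoc]⟩
  map_star' a := by
    rw [star_mk, mk_eq_mk]
    exact ⟨⊤, isDenseIdeal_top, fun x _ => by simp [multPair, starPair]⟩

/-- The inclusion `K_A → K_Q`, for a `*`-subalgebra `Q` of `Q_s(A)` that contains `A`. -/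
def skewIncl (Q : NonUnitalStarSubalgebra Φ (Qs Φ A)) (hAQ : ∀ a, incl Φ A a ∈ Q) :
    Skew Φ A →ₗ⁅Φ⁆ Skew Φ Q :=
  skewMap (NonUnitalStarAlgHom.codRestrict (incl Φ A) Q hAQ)

end Star

end Qs

end Martindale

/-!
Let `L = K_A` and `M = K_Q`. It suffices to find, for every homogeneous `q ∈ M`, a homogeneous
ideal `N` of `L` with `[N, q] ⊆ L` such that `[N, p] ⊆ Z_M` forces `p ∈ Z_M`. Indeed, the elements
absorbed by `N` are stable under `ad L`, so they contain all of `_L(q)`, and since `N` is spanned by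
its homogeneous elements one of these does not send a given noncentral `p` into the center.

Take `N = K_A ∩ I` for an essential ideal `I` of `A` with `qI + Iq ⊆ A`. Passing to the homogeneous
hull of `I` is harmless because `q` and `A` are homogeneous. For the derived algebras replace `N` by
`[N, N]`: by the Jacobi identity `[[N, N], q]` lies in `[L, L]`.

That `[K_A ∩ I, p] ⊆ Z_M` forces `p ∈ Z_M` comes from semiprimeness of `Q`. If `c = [p, x]` and
`[p, p²x + xp²]` centralize `K_Q`, then `c³ = 0` and hence `c = 0`, and an element of `K_Q` that
commutes with `K_A ∩ I` commutes with `K_Q`. For the derived algebras one also needs that a skew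
element `y` of a semiprime ring with `[y, [K, K]] ⊆ Z_K` centralizes `K`: the same argument gives
`[y, [y, k]] = 0` for skew `k`, so that `y²` is central and `[y, k]` is nilpotent.
-/

/-! ### Skew elements of semiprime rings with involution -/

section CentralElements

variable {R : Type*} [NonUnitalRing R]

theorem lie_lie_left (x y z : R) : ⁅⁅x, y⁆, z⁆ = ⁅x, ⁅y, z⁆⁆ - ⁅y, ⁅x, z⁆⁆ := by
  simp only [Ring.lie_def]
  noncomm_ring

theorem lie_mul_mul_add_mul_mul (p x : R) :
    ⁅p, p * p * x + x * (p * p)⁆ = p * p * ⁅p, x⁆ + ⁅p, x⁆ * (p * p) := by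
  simp only [Ring.lie_def]
  noncomm_ring

theorem eq_zero_of_commute_of_mul_self_eq_zero [IsSemiprimeAlg R] {c : R}
    (hc : ∀ a, Commute c a) (h : c * c = 0) : c = 0 :=
  IsSemiprimeAlg.eq_zero c fun a => by rw [(hc a).eq, mul_assoc, h, mul_zero]

theorem lie_cube_eq_zero_of_mul_lie_eq_zero {y k : R} (h : y * ⁅y, k⁆ = 0)
    (h3 : y * ⁅y, k * k * k⁆ = 0) : ⁅y, k⁆ * ⁅y, k⁆ * ⁅y, k⁆ = 0 := by
  have expand : y * ⁅y, k * k * k⁆ =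
      y * ⁅y, k⁆ * k * k + y * k * ⁅y, k⁆ * k + y * k * k * ⁅y, k⁆ := by
    simp only [Ring.lie_def]
    noncomm_ring
  have hyk : y * k = ⁅y, k⁆ + k * y := by rw [Ring.lie_def, sub_add_cancel]
  rw [expand] at h3
  generalize ⁅y, k⁆ = v at *
  have hsum : v * v * k + v * k * v + k * v * v = 0 := by
    linear_combination (norm := noncomm_ring)
      h3 - h * k * k - hyk * v * k - hyk * k * v - k * hyk * v - k * h * k - k * k * h
  linear_combination (norm := noncomm_ring)
    y * hsum - h * v * k - h * k * v - hyk * v * v - k * h * v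

variable (h2 : ∀ a : R, a + a = 0 → a = 0)
include h2

theorem eq_zero_of_forall_sandwich_sandwich_eq_zero [IsSemiprimeAlg R] {v : R}
    (h : ∀ a, v * a * v * a * v = 0) : v = 0 := by
  have swap (a b : R) : v * a * v * b * v = -(v * b * v * a * v) := by
    linear_combination (norm := noncomm_ring) h (a + b) - h a - h b
  have sandwich_three (a b c : R) : v * b * v * c * v * a * v = 0 := h2 _ <| by
    linear_combination (norm := noncomm_ring)
      swap a (b * v * c) - swap a b * c * v + v * b * swap a c
  refine IsSemiprimeAlg.eq_zero v fun a => IsSemiprimeAlg.eq_zero _ fun c => ?_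
  linear_combination (norm := noncomm_ring) sandwich_three a a c

theorem commute_of_forall_lie_lie_eq_zero [IsSemiprimeAlg R] {t : R}
    (h : ∀ a : R, ⁅t, ⁅t, a⁆⁆ = 0) (a : R) : Commute t a := by
  have lie_mul_lie (a b : R) : ⁅t, a⁆ * ⁅t, b⁆ = 0 := h2 _ <| by
    linear_combination (norm := (simp only [Ring.lie_def]; noncomm_ring))
      h (a * b) - h a * b - a * h b
  refine commute_iff_lie_eq.2 (IsSemiprimeAlg.eq_zero _ fun b => ?_)
  linear_combination (norm := (simp only [Ring.lie_def]; noncomm_ring))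
    lie_mul_lie a (b * a) - lie_mul_lie a b * a

theorem mul_mul_lie_add_lie_mul_eq_zero {p x c : R} (hp : Commute c p) (hx : Commute c x)
    (h : Commute (p * p * c + c * (p * p)) x) :
    c * (p * ⁅p, x⁆ + ⁅p, x⁆ * p) = 0 := h2 _ <| by
  have hpp : p * p * c = c * (p * p) := (hp.mul_right hp).eq.symm
  rw [hpp] at h
  linear_combination (norm := (simp only [Ring.lie_def]; noncomm_ring))
    h.eq - hx.eq * (p * p) - hx.eq * (p * p)

theorem lie_cube_eq_zero {p x : R} (hp : Commute ⁅p, x⁆ p) (hx : Commute ⁅p, x⁆ x)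
    (h : ⁅p, x⁆ * (p * ⁅p, x⁆ + ⁅p, x⁆ * p) = 0) : ⁅p, x⁆ * ⁅p, x⁆ * ⁅p, x⁆ = 0 := by
  have hccp : ⁅p, x⁆ * ⁅p, x⁆ * p = 0 := h2 _ <| by
    linear_combination (norm := noncomm_ring) h + ⁅p, x⁆ * hp.eq
  have hccx : Commute (⁅p, x⁆ * ⁅p, x⁆) x := hx.mul_left hx
  calc ⁅p, x⁆ * ⁅p, x⁆ * ⁅p, x⁆ = ⁅p, x⁆ * ⁅p, x⁆ * p * x - ⁅p, x⁆ * ⁅p, x⁆ * x * p := by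
        nth_rw 3 [Ring.lie_def]
        noncomm_ring
    _ = 0 := by rw [hccx.eq, mul_assoc x, hccp, zero_mul, mul_zero, sub_zero]

theorem mul_lie_eq_zero_of_lie_lie_eq_zero {y k : R} (hy : Commute (y * y) k)
    (h : ⁅y, ⁅y, k⁆⁆ = 0) : y * ⁅y, k⁆ = 0 := h2 _ <| by
  linear_combination (norm := (simp only [Ring.lie_def]; noncomm_ring)) h + hy.eq

end CentralElements

section SkewElements

variable {R : Type*} [NonUnitalRing R] [StarRing R]

theorem sub_star_mem_skewAdjoint (a : R) : a - star a ∈ skewAdjoint R := by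
  rw [skewAdjoint.mem_iff, star_sub, star_star, neg_sub]

theorem lie_mem_skewAdjoint {x y : R} (hx : x ∈ skewAdjoint R) (hy : y ∈ skewAdjoint R) :
    ⁅x, y⁆ ∈ skewAdjoint R := by
  rw [skewAdjoint.mem_iff] at *
  simp [Ring.lie_def, hx, hy]

theorem mul_mul_star_mem_skewAdjoint {x : R} (hx : x ∈ skewAdjoint R) (a : R) :
    a * x * star a ∈ skewAdjoint R := by
  rw [skewAdjoint.mem_iff] at *
  simp [hx, mul_assoc]

theorem mul_mul_self_mem_skewAdjoint {x y : R} (hx : x ∈ skewAdjoint R)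
    (hy : y ∈ skewAdjoint R) : x * y * x ∈ skewAdjoint R := by
  rw [skewAdjoint.mem_iff] at *
  simp [hx, hy, mul_assoc]

theorem mul_add_star_mul_mem_skewAdjoint {x : R} (hx : x ∈ skewAdjoint R) (a : R) :
    x * a + star a * x ∈ skewAdjoint R := by
  rw [skewAdjoint.mem_iff] at *
  simp [hx, add_comm]

theorem mul_mul_add_mul_mul_mem_skewAdjoint {x y : R} (hx : x ∈ skewAdjoint R)
    (hy : y ∈ skewAdjoint R) : x * x * y + y * (x * x) ∈ skewAdjoint R := by
  rw [skewAdjoint.mem_iff] at *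
  simp [hx, hy, mul_assoc, add_comm]

theorem commute_mul_self_of_commute_skewAdjoint {c : R} (hc : c ∈ skewAdjoint R)
    (h : ∀ k ∈ skewAdjoint R, Commute c k) (a : R) : Commute (c * c) a := by
  have hskew := (h _ (sub_star_mem_skewAdjoint (star a))).eq
  have hmul := (h _ (mul_add_star_mul_mem_skewAdjoint hc (star a))).eq
  rw [star_star] at hskew hmul
  change c * c * a = a * (c * c)
  linear_combination (norm := noncomm_ring) hmul - c * hskew

theorem commute_mul_self_of_lie_lie_skewAdjoint_eq_zero [IsSemiprimeAlg R]
    (h2 : ∀ a : R, a + a = 0 → a = 0) {y : R} (hy : y ∈ skewAdjoint R)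
    (h : ∀ k ∈ skewAdjoint R, ⁅y, ⁅y, k⁆⁆ = 0) (a : R) : Commute (y * y) a := by
  have lie_sq_lie (a : R) : ⁅y * y, ⁅y, a⁆⁆ = 0 := by
    linear_combination (norm := (simp only [Ring.lie_def]; noncomm_ring))
      h _ (mul_add_star_mul_mem_skewAdjoint hy a) + h _ (sub_star_mem_skewAdjoint a) * y
  refine commute_of_forall_lie_lie_eq_zero h2 (fun a => ?_) a
  linear_combination (norm := (simp only [Ring.lie_def]; noncomm_ring))
    y * lie_sq_lie a + lie_sq_lie a * y

section Semiprime

variable [IsSemiprimeAlg R] (h2 : ∀ a : R, a + a = 0 → a = 0)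
include h2

theorem eq_zero_of_sandwich_skewAdjoint_eq_zero {v : R} (hv : v ∈ skewAdjoint R)
    (h : ∀ k ∈ skewAdjoint R, v * k * v = 0) : v = 0 := by
  refine eq_zero_of_forall_sandwich_sandwich_eq_zero h2 fun a => ?_
  linear_combination (norm := noncomm_ring)
    h _ (mul_mul_star_mem_skewAdjoint hv a) + v * a * h _ (sub_star_mem_skewAdjoint a)

theorem eq_zero_of_commute_skewAdjoint_of_cube_eq_zero {c : R} (hc : c ∈ skewAdjoint R)
    (h : ∀ k ∈ skewAdjoint R, Commute c k) (h3 : c * c * c = 0) : c = 0 := by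
  have hcc : c * c = 0 :=
    eq_zero_of_commute_of_mul_self_eq_zero (commute_mul_self_of_commute_skewAdjoint hc h) <| by
      rw [← mul_assoc, h3, zero_mul]
  exact eq_zero_of_sandwich_skewAdjoint_eq_zero h2 hc fun k hk => by
    rw [(h k hk).eq, mul_assoc, hcc, mul_zero]

theorem lie_eq_zero_of_commute_lie_of_commute_lie_jordan {p x : R} (hp : p ∈ skewAdjoint R)
    (hx : x ∈ skewAdjoint R) (hc : ∀ k ∈ skewAdjoint R, Commute ⁅p, x⁆ k)
    (h : Commute ⁅p, p * p * x + x * (p * p)⁆ x) : ⁅p, x⁆ = 0 := by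
  rw [lie_mul_mul_add_mul_mul] at h
  exact eq_zero_of_commute_skewAdjoint_of_cube_eq_zero h2 (lie_mem_skewAdjoint hp hx) hc
    (lie_cube_eq_zero h2 (hc p hp) (hc x hx)
      (mul_mul_lie_add_lie_mul_eq_zero h2 (hc p hp) (hc x hx) h))

theorem lie_lie_eq_zero_of_commute_lie_derived {y : R} (hy : y ∈ skewAdjoint R)
    (h : ∀ a ∈ skewAdjoint R, ∀ b ∈ skewAdjoint R, ∀ c ∈ skewAdjoint R, Commute ⁅y, ⁅a, b⁆⁆ c)
    {k : R} (hk : k ∈ skewAdjoint R) : ⁅y, ⁅y, k⁆⁆ = 0 := by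
  have hv : ⁅y, k⁆ ∈ skewAdjoint R := lie_mem_skewAdjoint hy hk
  have hc : ∀ a ∈ skewAdjoint R, Commute ⁅y, ⁅y, k⁆⁆ a := h y hy k hk
  have jordan : ⁅y, ⁅y, k⁆⁆ * (y * ⁅y, k⁆ + ⁅y, k⁆ * y) = 0 := by
    refine mul_mul_lie_add_lie_mul_eq_zero h2 (hc y hy) (hc k hk) ?_
    have := h y hy _ (mul_mul_add_mul_mul_mem_skewAdjoint hy hk) k hk
    rwa [lie_mul_mul_add_mul_mul, lie_mul_mul_add_mul_mul] at this
  refine eq_zero_of_commute_skewAdjoint_of_cube_eq_zero h2 (lie_mem_skewAdjoint hy hv) hc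
    (lie_cube_eq_zero h2 (hc y hy) (hc _ hv) ?_)
  have lie_jordan : ⁅y, y * ⁅y, k⁆ + ⁅y, k⁆ * y⁆ = y * ⁅y, ⁅y, k⁆⁆ + ⁅y, ⁅y, k⁆⁆ * y := by
    simp only [Ring.lie_def]
    noncomm_ring
  rw [← lie_jordan, Ring.lie_def y (_ + _), mul_sub, ← mul_assoc, (hc y hy).eq, mul_assoc,
    ← mul_assoc _ (_ + _), jordan, mul_zero, zero_mul, sub_zero]

theorem commute_skewAdjoint_of_commute_lie_derived {y : R} (hy : y ∈ skewAdjoint R)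
    (h : ∀ a ∈ skewAdjoint R, ∀ b ∈ skewAdjoint R, ∀ c ∈ skewAdjoint R, Commute ⁅y, ⁅a, b⁆⁆ c)
    {k : R} (hk : k ∈ skewAdjoint R) : Commute y k := by
  have hv : ⁅y, k⁆ ∈ skewAdjoint R := lie_mem_skewAdjoint hy hk
  have hlie : ∀ a ∈ skewAdjoint R, ∀ b ∈ skewAdjoint R, ∀ c ∈ skewAdjoint R,
      Commute ⁅⁅y, k⁆, ⁅a, b⁆⁆ c := fun a ha b hb c hc => by
    rw [lie_lie_left, (commute_iff_lie_eq.1 (h a ha b hb k hk).symm), sub_zero]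
    exact h k hk _ (lie_mem_skewAdjoint ha hb) c hc
  have lie_lie_y : ∀ l ∈ skewAdjoint R, ⁅y, ⁅y, l⁆⁆ = 0 := fun l =>
    lie_lie_eq_zero_of_commute_lie_derived h2 hy h
  have lie_lie_v : ∀ l ∈ skewAdjoint R, ⁅⁅y, k⁆, ⁅⁅y, k⁆, l⁆⁆ = 0 := fun l =>
    lie_lie_eq_zero_of_commute_lie_derived h2 hv hlie
  have mul_lie (l) (hl : l ∈ skewAdjoint R) : y * ⁅y, l⁆ = 0 :=
    mul_lie_eq_zero_of_lie_lie_eq_zero h2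
      (commute_mul_self_of_lie_lie_skewAdjoint_eq_zero h2 hy lie_lie_y l) (lie_lie_y l hl)
  have hvv : ⁅y, k⁆ * ⁅y, k⁆ = 0 := by
    refine eq_zero_of_commute_of_mul_self_eq_zero
      (commute_mul_self_of_lie_lie_skewAdjoint_eq_zero h2 hv lie_lie_v) ?_
    rw [← mul_assoc, lie_cube_eq_zero_of_mul_lie_eq_zero (mul_lie k hk)
      (mul_lie _ (mul_mul_self_mem_skewAdjoint hk hk)), zero_mul]
  refine commute_iff_lie_eq.2 (eq_zero_of_sandwich_skewAdjoint_eq_zero h2 hv fun l hl => h2 _ ?_)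
  linear_combination (norm := skip) hvv * l + l * hvv - lie_lie_v l hl
  generalize ⁅y, k⁆ = v
  simp only [Ring.lie_def]
  noncomm_ring

end Semiprime

end SkewElements

/-! ### Rings of quotients of a ring with involution -/

section DenseFamily

variable {Φ R : Type*} [CommRing Φ] [NonUnitalRing R] [StarRing R] [Module Φ R]

theorem mul_mul_skewAdjoint_eq_zero {J : NonUnitalStarSubalgebra Φ R} {w : R}
    (hw : ∀ x ∈ J, x ∈ skewAdjoint R → w * x = 0)
    {a k : R} (ha : a ∈ J) (hk : k ∈ J) (hk' : k ∈ skewAdjoint R) : w * a * k = 0 := by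
  have hsub := hw _ (sub_mem ha (star_mem ha)) (sub_star_mem_skewAdjoint a)
  have hadd := hw _ (add_mem (mul_mem hk ha) (mul_mem (star_mem ha) hk))
    (mul_add_star_mul_mem_skewAdjoint hk' a)
  linear_combination (norm := noncomm_ring) hsub * k + hadd - hw k hk hk' * a

theorem sandwich_mul_eq_zero (h2 : ∀ a : R, a + a = 0 → a = 0)
    {J : NonUnitalStarSubalgebra Φ R} {w : R} (hc : ∀ x ∈ J, x ∈ skewAdjoint R → Commute w x)
    (h0 : ∀ x ∈ J, x ∈ skewAdjoint R → w * x * x = 0) {x j : R} (hx : x ∈ J)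
    (hx' : x ∈ skewAdjoint R) (hj : j ∈ J) : w * x * j * (w * x) = 0 := h2 _ <| by
  have anticomm : ∀ y ∈ J, y ∈ skewAdjoint R → w * x * y + w * y * x = 0 := fun y hy hy' => by
    linear_combination (norm := noncomm_ring)
      h0 (x + y) (add_mem hx hy) (add_mem hx' hy') - h0 x hx hx' - h0 y hy hy'
  have hwx := (hc x hx hx').eq
  have hxxw : x * x * w = 0 := by
    linear_combination (norm := noncomm_ring) h0 x hx hx' - hwx * x - x * hwx
  have hsub := anticomm _ (sub_mem hj (star_mem hj)) (sub_star_mem_skewAdjoint j)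
  have hadd := anticomm _ (add_mem (mul_mem hx hj) (mul_mem (star_mem hj) hx))
    (mul_add_star_mul_mem_skewAdjoint hx' j)
  linear_combination (norm := noncomm_ring) w * x * j * hwx + w * x * j * hwx
    + hsub * x * w + hadd * w - w * (j - star j) * hxxw - w * star j * hxxw - h0 x hx hx' * j * w

/-- A family of `*`-subalgebras of `R` that behaves like the essential `*`-ideals of a ring of which
`R` is a ring of quotients. -/
structure IsDenseFamily (F : Set (NonUnitalStarSubalgebra Φ R)) : Prop where
  exists_le : ∀ J ∈ F, ∀ q : R, ∃ J' ∈ F, J' ≤ J ∧ ∀ j ∈ J', q * j ∈ J ∧ j * q ∈ J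
  eq_zero : ∀ J ∈ F, ∀ q : R, (∀ j ∈ J, q * j * q = 0) → q = 0

namespace IsDenseFamily

variable {F : Set (NonUnitalStarSubalgebra Φ R)} (hF : IsDenseFamily F)
  (h2 : ∀ a : R, a + a = 0 → a = 0) {J : NonUnitalStarSubalgebra Φ R} (hJ : J ∈ F)

include hF hJ

theorem isSemiprimeAlg : IsSemiprimeAlg R := ⟨fun a h => hF.eq_zero J hJ a fun j _ => h j⟩

theorem isSemiprimeAlg_of_mem : IsSemiprimeAlg J :=
  ⟨fun a h => Subtype.ext (hF.eq_zero J hJ a fun j hj => congrArg Subtype.val (h ⟨j, hj⟩))⟩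

include h2

theorem eq_zero_of_mul_skewAdjoint_eq_zero {w : R} (hw : w ∈ skewAdjoint R)
    (hl : ∀ x ∈ J, x ∈ skewAdjoint R → w * x = 0)
    (hr : ∀ x ∈ J, x ∈ skewAdjoint R → x * w = 0) : w = 0 := by
  obtain ⟨J', hJ', hle, hJw⟩ := hF.exists_le J hJ w
  have hsub (a) (ha : a ∈ J') : (a - star a) * w = 0 :=
    hr _ (hle (sub_mem ha (star_mem ha))) (sub_star_mem_skewAdjoint a)
  have hJw' (a) (ha : a ∈ J') : w * a + star a * w ∈ J :=
    add_mem (hJw a ha).1 (hJw _ (star_mem ha)).2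
  have hadd (a) (ha : a ∈ J') : w * w * a + w * a * w = 0 := by
    linear_combination (norm := noncomm_ring)
      hl _ (hJw' a ha) (mul_add_star_mul_mem_skewAdjoint hw a) + w * hsub a ha
  have hmul (a) (ha : a ∈ J') (b) (hb : b ∈ J') : w * a * (w * b + b * w) = 0 := by
    linear_combination (norm := noncomm_ring) w * a * hsub b hb +
      mul_mul_skewAdjoint_eq_zero hl (hle ha) (hJw' b hb) (mul_add_star_mul_mem_skewAdjoint hw b)
  have sq_mul_mul (a) (ha : a ∈ J') (b) (hb : b ∈ J') : w * w * a * b = 0 := h2 _ <| by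
    linear_combination (norm := noncomm_ring)
      hadd _ (mul_mem ha hb) - hmul a ha b hb + hadd a ha * b
  have sq_mul (a) (ha : a ∈ J') : w * w * a = 0 := hF.eq_zero J' hJ' _ fun j hj => by
    rw [sq_mul_mul a ha j hj, zero_mul]
  exact hF.eq_zero J' hJ' w fun j hj => by simpa only [sq_mul j hj, zero_add] using hadd j hj

theorem eq_zero_of_commute_of_mul_mul_self_eq_zero {w : R} (hw : w ∈ skewAdjoint R)
    (hc : ∀ x ∈ J, x ∈ skewAdjoint R → Commute w x)
    (h0 : ∀ x ∈ J, x ∈ skewAdjoint R → w * x * x = 0) : w = 0 := by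
  have hl : ∀ x ∈ J, x ∈ skewAdjoint R → w * x = 0 := fun x hx hx' =>
    hF.eq_zero J hJ _ fun j hj => sandwich_mul_eq_zero h2 hc h0 hx hx' hj
  exact hF.eq_zero_of_mul_skewAdjoint_eq_zero h2 hJ hw hl fun x hx hx' =>
    (hc x hx hx').eq ▸ hl x hx hx'

theorem commute_skewAdjoint_of_commute_mem {p : R} (hp : p ∈ skewAdjoint R)
    (h : ∀ x ∈ J, x ∈ skewAdjoint R → Commute p x) {q : R} (hq : q ∈ skewAdjoint R) :
    Commute p q := by
  obtain ⟨J', hJ', hle, hJq⟩ := hF.exists_le J hJ q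
  have hlie : ∀ x ∈ J', x ∈ skewAdjoint R → Commute ⁅p, q⁆ x := fun x hx hx' => by
    have hqx : ⁅q, x⁆ ∈ J := sub_mem (hJq x hx).1 (hJq x hx).2
    rw [commute_iff_lie_eq, lie_lie_left, (h _ hqx (lie_mem_skewAdjoint hq hx')).lie_eq,
      (h x (hle hx) hx').lie_eq, Ring.lie_def q 0, mul_zero, zero_mul, sub_zero, sub_zero]
  refine commute_iff_lie_eq.2 <| hF.eq_zero_of_commute_of_mul_mul_self_eq_zero h2 hJ'
    (lie_mem_skewAdjoint hp hq) hlie fun x hx hx' => ?_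
  have hpx := h x (hle hx) hx'
  have hpxqx := h _ (mul_mem (hJq x hx).2 (hle hx)) (mul_mul_self_mem_skewAdjoint hx' hq)
  rw [(hlie x hx hx').eq]
  linear_combination (norm := (simp only [Ring.lie_def]; noncomm_ring))
    hpxqx.eq - hpx.eq * q * x - x * q * hpx.eq

theorem commute_skewAdjoint_of_commute_lie {p : R} (hp : p ∈ skewAdjoint R)
    (h : ∀ x ∈ J, x ∈ skewAdjoint R → ∀ k ∈ skewAdjoint R, Commute ⁅p, x⁆ k)
    {q : R} (hq : q ∈ skewAdjoint R) : Commute p q := by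
  have := hF.isSemiprimeAlg hJ
  obtain ⟨J₁, hJ₁, hle₁, hJp₁⟩ := hF.exists_le J hJ p
  obtain ⟨J₂, hJ₂, hle₂, hJp₂⟩ := hF.exists_le J₁ hJ₁ p
  refine hF.commute_skewAdjoint_of_commute_mem h2 hJ₂ hp (fun x hx hx' => ?_) hq
  have hjordan : p * p * x + x * (p * p) ∈ J := add_mem
    (mul_assoc p p x ▸ (hJp₁ _ (hJp₂ x hx).1).1) (mul_assoc x p p ▸ (hJp₁ _ (hJp₂ x hx).2).2)
  exact commute_iff_lie_eq.2 <| lie_eq_zero_of_commute_lie_of_commute_lie_jordan h2 hp hx'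
    (h x (hle₁ (hle₂ hx)) hx') (h _ hjordan (mul_mul_add_mul_mul_mem_skewAdjoint hp hx') x hx')

theorem commute_skewAdjoint_of_commute_lie_lie {p : R} (hp : p ∈ skewAdjoint R)
    (h : ∀ x ∈ J, x ∈ skewAdjoint R → ∀ y ∈ J, y ∈ skewAdjoint R → ∀ k ∈ skewAdjoint R,
      Commute ⁅p, ⁅x, y⁆⁆ k)
    {q : R} (hq : q ∈ skewAdjoint R) : Commute p q := by
  have := hF.isSemiprimeAlg_of_mem hJ
  obtain ⟨J', hJ', hle, hJp⟩ := hF.exists_le J hJ p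
  refine hF.commute_skewAdjoint_of_commute_lie h2 hJ' hp (fun x hx hx' k hk => ?_) hq
  have hpx : ⁅p, x⁆ ∈ J := sub_mem (hJp x hx).1 (hJp x hx).2
  have hpx' := lie_mem_skewAdjoint hp hx'
  refine hF.commute_skewAdjoint_of_commute_mem h2 hJ hpx' (fun z hz hz' => ?_) hk
  have key := commute_skewAdjoint_of_commute_lie_derived (R := J)
    (fun a ha => Subtype.ext (h2 _ (congrArg Subtype.val ha)))
    (y := ⟨⁅p, x⁆, hpx⟩) (Subtype.ext hpx') (fun a ha b hb c hc => Subtype.ext ?_) (k := ⟨z, hz⟩)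
    (Subtype.ext hz')
  · exact congrArg Subtype.val key
  replace ha : (a : R) ∈ skewAdjoint R := congrArg Subtype.val ha
  replace hb : (b : R) ∈ skewAdjoint R := congrArg Subtype.val hb
  replace hc : (c : R) ∈ skewAdjoint R := congrArg Subtype.val hc
  have hab : ⁅(a : R), (b : R)⁆ ∈ J := sub_mem (mul_mem a.2 b.2) (mul_mem b.2 a.2)
  change Commute ⁅⁅p, x⁆, ⁅(a : R), (b : R)⁆⁆ c
  rw [lie_lie_left, (h a a.2 ha b b.2 hb x hx').symm.lie_eq, sub_zero]
  exact h x (hle hx) hx' _ hab (lie_mem_skewAdjoint ha hb) c hc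

theorem commute_skewAdjoint_of_commute_lie_derived {p : R} (hp : p ∈ skewAdjoint R)
    (h : ∀ x ∈ J, x ∈ skewAdjoint R → ∀ y ∈ J, y ∈ skewAdjoint R → ∀ k ∈ skewAdjoint R,
      ∀ l ∈ skewAdjoint R, Commute ⁅p, ⁅x, y⁆⁆ ⁅k, l⁆)
    {q : R} (hq : q ∈ skewAdjoint R) : Commute p q := by
  have := hF.isSemiprimeAlg hJ
  refine hF.commute_skewAdjoint_of_commute_lie_lie h2 hJ hp (fun x hx hx' y hy hy' k hk => ?_) hq
  have hw := lie_mem_skewAdjoint hp (lie_mem_skewAdjoint hx' hy')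
  refine _root_.commute_skewAdjoint_of_commute_lie_derived h2 hw (fun a ha b hb c _ => ?_) hk
  rw [(h x hx hx' y hy hy' a ha b hb).lie_eq]
  exact Commute.zero_left c

end IsDenseFamily

end DenseFamily

namespace Martindale

section IsDenseIdeal

variable {Φ A : Type*} [CommRing Φ] [NonUnitalRing A] [Module Φ A] {I : Submodule Φ A}

theorem IsDenseIdeal.of_le {K : Submodule Φ A} (hK : IsDenseIdeal K) (hKI : K ≤ I)
    (mul_left : ∀ a, ∀ x ∈ I, a * x ∈ I) (mul_right : ∀ a, ∀ x ∈ I, x * a ∈ I) :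
    IsDenseIdeal I where
  mul_left := mul_left
  mul_right := mul_right
  left_ann a ha := hK.left_ann a fun x hx => ha x (hKI hx)
  right_ann a ha := hK.right_ann a fun x hx => ha x (hKI hx)

theorem IsDenseIdeal.eq_zero_of_sandwich [IsSemiprimeAlg A] (hI : IsDenseIdeal I) {a : A}
    (h : ∀ j ∈ I, a * j * a = 0) : a = 0 :=
  hI.left_ann a fun j hj => IsSemiprimeAlg.eq_zero _ fun b => by
    linear_combination (norm := noncomm_ring) h _ (hI.mul_right b j hj) * j

variable [StarRing Φ] [TrivialStar Φ] [StarRing A] [StarModule Φ A]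

theorem IsDenseIdeal.exists_starSubalgebra_le (hI : IsDenseIdeal I) :
    ∃ S : NonUnitalStarSubalgebra Φ A, IsDenseIdeal S.toSubmodule ∧ S.toSubmodule ≤ I := by
  obtain ⟨K, hK, hmem⟩ := hI.exists_star
  exact ⟨{ I ⊓ K with
    mul_mem' := fun {a b} _ hb => (hI.inf hK).mul_left a b hb
    star_mem' := fun {a} ha => ⟨(hmem a).1 ha.2, (hmem _).2 (by rw [star_star]; exact ha.1)⟩ },
    hI.inf hK, inf_le_left⟩

end IsDenseIdeal

variable {Φ A R : Type*} [CommRing Φ] [NonUnitalRing A] [Module Φ A] [StarRing A]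
  [NonUnitalRing R] [Module Φ R] [StarRing R]

/-- The embedding `ι` makes `R` an algebra of symmetric quotients of `A`: every element of `R` can
be multiplied into `A` by an essential ideal, from both sides, and no nonzero element of `R` is
annihilated by one. The algebras with this property are those between `A` and `Q_s(A)`. -/
structure IsSymmetricQuotientMap (ι : A →⋆ₙₐ[Φ] R) : Prop where
  injective : Function.Injective ι
  exists_mul_mem : ∀ q : R, ∀ I : Submodule Φ A, IsDenseIdeal I →
    ∃ K : Submodule Φ A, IsDenseIdeal K ∧ K ≤ I ∧
      ∀ k ∈ K, (∃ a ∈ I, ι a = q * ι k) ∧ ∃ a ∈ I, ι a = ι k * q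
  eq_zero : ∀ q : R, ∀ I : Submodule Φ A, IsDenseIdeal I →
    (∀ k ∈ I, q * ι k = 0) → (∀ k ∈ I, ι k * q = 0) → q = 0

namespace IsSymmetricQuotientMap

variable {ι : A →⋆ₙₐ[Φ] R} (hι : IsSymmetricQuotientMap ι) [IsSemiprimeAlg A]
include hι

theorem eq_zero_of_sandwich {q : R} {I : Submodule Φ A} (hI : IsDenseIdeal I)
    (h : ∀ j ∈ I, q * ι j * q = 0) : q = 0 := by
  have eq_zero_of_map_sandwich (a : A) (ha : ∀ j ∈ I, ι a * ι j * ι a = 0) : a = 0 :=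
    hI.eq_zero_of_sandwich fun j hj => hι.injective <| by
      simpa only [map_mul, map_zero] using ha j hj
  obtain ⟨K, hK, -, hKq⟩ := hι.exists_mul_mem q I hI
  refine hι.eq_zero q K hK (fun k hk => ?_) fun k hk => ?_
  · obtain ⟨a, -, ha⟩ := (hKq k hk).1
    rw [← ha, eq_zero_of_map_sandwich a fun j hj => ?_, map_zero]
    have := h _ (hI.mul_left k j hj)
    rw [map_mul] at this
    rw [ha]
    linear_combination (norm := noncomm_ring) this * ι k
  · obtain ⟨a, -, ha⟩ := (hKq k hk).2
    rw [← ha, eq_zero_of_map_sandwich a fun j hj => ?_, map_zero]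
    have := h _ (hI.mul_right k j hj)
    rw [map_mul] at this
    rw [ha]
    linear_combination (norm := noncomm_ring) ι k * this

theorem eq_zero_of_add_self (h2 : ∀ a : A, a + a = 0 → a = 0) (q : R) (h : q + q = 0) :
    q = 0 := by
  have map_eq_zero (a : A) (ha : ι a + ι a = 0) : ι a = 0 := by
    rw [h2 a (hι.injective (by rw [map_add, ha, map_zero])), map_zero]
  obtain ⟨K, hK, -, hKq⟩ := hι.exists_mul_mem q ⊤ isDenseIdeal_top
  refine hι.eq_zero q K hK (fun k hk => ?_) fun k hk => ?_
  · obtain ⟨a, -, ha⟩ := (hKq k hk).1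
    rw [← ha, map_eq_zero a (by rw [ha, ← add_mul, h, zero_mul])]
  · obtain ⟨a, -, ha⟩ := (hKq k hk).2
    rw [← ha, map_eq_zero a (by rw [ha, ← mul_add, h, mul_zero])]

end IsSymmetricQuotientMap

section DenseFamily

variable [StarRing Φ] [StarModule Φ A]

/-- The images in `R` of the essential `*`-ideals of `A`. -/
def denseFamily (ι : A →⋆ₙₐ[Φ] R) : Set (NonUnitalStarSubalgebra Φ R) :=
  NonUnitalStarSubalgebra.map ι '' {S | IsDenseIdeal S.toSubmodule}

theorem IsSymmetricQuotientMap.isDenseFamily [TrivialStar Φ] [IsSemiprimeAlg A] {ι : A →⋆ₙₐ[Φ] R}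
    (hι : IsSymmetricQuotientMap ι) : IsDenseFamily (denseFamily ι) where
  exists_le := by
    rintro _ ⟨S, hS, rfl⟩ q
    obtain ⟨K, hK, hKS, hKq⟩ := hι.exists_mul_mem q _ hS
    obtain ⟨S', hS', hS'K⟩ := hK.exists_starSubalgebra_le
    refine ⟨S'.map ι, ⟨S', hS', rfl⟩, NonUnitalStarSubalgebra.map_mono (hS'K.trans hKS), ?_⟩
    rintro _ ⟨k, hk, rfl⟩
    exact hKq k (hS'K hk)
  eq_zero := by
    rintro _ ⟨S, hS, rfl⟩ q h
    exact hι.eq_zero_of_sandwich hS fun j hj => h _ ⟨j, hj, rfl⟩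

end DenseFamily

namespace Qs

variable [IsScalarTower Φ A A] [SMulCommClass Φ A A] [IsSemiprimeAlg A] [StarRing Φ]
  [TrivialStar Φ] [StarModule Φ A]

theorem incl_injective : Function.Injective (incl Φ A) := by
  refine (injective_iff_map_eq_zero _).2 fun a ha => ?_
  obtain ⟨J, hJ, h⟩ := mk_eq_mk.1 (ha.trans (map_zero mk).symm : mk (multPair a) = mk 0)
  exact hJ.left_ann a fun x hx => (h x hx).1

variable {p : pairs Φ A} {J : Submodule Φ A} (hJ : IsDenseIdeal J)
  (hp : IsCompatiblePair J p.1.1 p.1.2) {x : A} (hx : x ∈ J)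

include hJ hp hx

theorem mk_mul_incl : mk p * incl Φ A x = incl Φ A (p.1.1 x) :=
  mk_eq_mk.2 ⟨J, hJ, fun y hy => ⟨hp.f_mul x hx y, (hp.compat y hy x hx).symm⟩⟩

theorem incl_mul_mk : incl Φ A x * mk p = incl Φ A (p.1.2 x) :=
  mk_eq_mk.2 ⟨J, hJ, fun y hy => ⟨hp.compat x hx y hy, hp.g_mul x hx y⟩⟩

omit hJ hp hx

theorem isSymmetricQuotientMap_incl : IsSymmetricQuotientMap (incl Φ A) where
  injective := incl_injective
  exists_mul_mem q I hI := by
    obtain ⟨p, rfl⟩ := mk_surjective q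
    obtain ⟨J, hJ, hp⟩ := p.2
    obtain ⟨K, hK, hKI, hKJ, hf, hg⟩ := exists_dense hJ hp hI
    exact ⟨K, hK, hKI, fun k hk => ⟨⟨_, hf k hk, (mk_mul_incl hJ hp (hKJ hk)).symm⟩,
      ⟨_, hg k hk, (incl_mul_mk hJ hp (hKJ hk)).symm⟩⟩⟩
  eq_zero q I hI hl hr := by
    obtain ⟨p, rfl⟩ := mk_surjective q
    obtain ⟨J, hJ, hp⟩ := p.2
    rw [← map_zero mk, mk_eq_mk]
    refine ⟨J ⊓ I, hJ.inf hI, fun x hx => ⟨incl_injective (Φ := Φ) ?_, incl_injective (Φ := Φ) ?_⟩⟩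
    · exact (mk_mul_incl hJ hp hx.1).symm.trans ((hl x hx.2).trans (map_zero _).symm)
    · exact (incl_mul_mk hJ hp hx.1).symm.trans ((hr x hx.2).trans (map_zero _).symm)

end Qs

theorem IsSymmetricQuotientMap.codRestrict {ι : A →⋆ₙₐ[Φ] R}
    (hι : IsSymmetricQuotientMap ι) (Q : NonUnitalStarSubalgebra Φ R) (hQ : ∀ a, ι a ∈ Q) :
    IsSymmetricQuotientMap (NonUnitalStarAlgHom.codRestrict ι Q hQ) where
  injective _ _ h := hι.injective (congrArg Subtype.val h)
  exists_mul_mem q I hI := by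
    obtain ⟨K, hK, hKI, hKq⟩ := hι.exists_mul_mem q I hI
    exact ⟨K, hK, hKI, fun k hk =>
      ⟨(hKq k hk).1.imp fun _ h => ⟨h.1, Subtype.ext h.2⟩,
        (hKq k hk).2.imp fun _ h => ⟨h.1, Subtype.ext h.2⟩⟩⟩
  eq_zero q I hI hl hr := Subtype.ext <| hι.eq_zero q I hI
    (fun k hk => congrArg Subtype.val (hl k hk)) fun k hk => congrArg Subtype.val (hr k hk)

end Martindale

/-! ### Homogeneous submodules -/

section Homogeneous

open DirectSum

variable {Φ I J V W : Type*} [CommRing Φ] [AddCommGroup V] [Module Φ V] [AddCommGroup W]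
  [Module Φ W] [DecidableEq I] [DecidableEq J]

theorem isInternal_of_projections {𝒱 : I → Submodule Φ V} (π : I → V →ₗ[Φ] V)
    (same : ∀ i, ∀ v ∈ 𝒱 i, π i v = v) (ne : ∀ i j, i ≠ j → ∀ v ∈ 𝒱 i, π j v = 0)
    (top_le : ⊤ ≤ ⨆ i, 𝒱 i) : IsInternal 𝒱 := by
  refine (isInternal_submodule_iff_iSupIndep_and_iSup_eq_top 𝒱).2 ⟨fun i => ?_, top_le_iff.1 top_le⟩
  rw [Submodule.disjoint_def]
  intro v hv hv'
  have hker : ⨆ j, ⨆ (_ : j ≠ i), 𝒱 j ≤ LinearMap.ker (π i) := iSup₂_le fun j hj => ne j i hj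
  rw [← same i v hv]
  exact hker hv'

variable (𝒱 : I → Submodule Φ V) [Decomposition 𝒱] {𝒲 : J → Submodule Φ W} [Decomposition 𝒲]

/-- The projection of `V` onto the component of degree `i` of its grading `𝒱`. -/
def componentProj (i : I) : V →ₗ[Φ] V :=
  (𝒱 i).subtype ∘ₗ component Φ I (fun i => 𝒱 i) i ∘ₗ (decomposeLinearEquiv 𝒱).toLinearMap

theorem mem_iSup_inf {N : Submodule Φ V} (hN : N.IsHomogeneous 𝒱) {v : V} (hv : v ∈ N) :
    v ∈ ⨆ i, N ⊓ 𝒱 i := by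
  classical
  rw [← sum_support_decompose 𝒱 v]
  exact sum_mem fun i _ => Submodule.mem_iSup_of_mem i ⟨hN i hv, (decompose 𝒱 v i).2⟩

variable {𝒱}

theorem componentProj_mem {N : Submodule Φ V} (hN : N.IsHomogeneous 𝒱) (i : I) (v : V)
    (hv : v ∈ N) : componentProj 𝒱 i v ∈ N := hN i hv

theorem componentProj_same (i : I) (v : V) (hv : v ∈ 𝒱 i) : componentProj 𝒱 i v = v :=
  decompose_of_mem_same 𝒱 hv

theorem componentProj_ne (i j : I) (hij : i ≠ j) (v : V) (hv : v ∈ 𝒱 i) :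
    componentProj 𝒱 j v = 0 := decompose_of_mem_ne 𝒱 hv hij

theorem isInternal_comap_subtype {N : Submodule Φ V} (hN : N.IsHomogeneous 𝒱) :
    IsInternal fun i => (𝒱 i).comap N.subtype := by
  refine isInternal_of_projections (fun i => (componentProj 𝒱 i).restrict (componentProj_mem hN i))
    (fun i v hv => Subtype.ext (componentProj_same i (v : V) hv))
    (fun i j hij v hv => Subtype.ext (componentProj_ne i j hij (v : V) hv)) fun v _ => ?_
  obtain ⟨w, hw, hwv⟩ : (v : V) ∈ (⨆ i, (𝒱 i).comap N.subtype).map N.subtype := by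
    simpa only [Submodule.map_iSup, Submodule.map_comap_subtype] using mem_iSup_inf 𝒱 hN v.2
  rwa [← Subtype.ext hwv]

theorem isInternal_map_mkQ {N : Submodule Φ V} (hN : N.IsHomogeneous 𝒱) :
    IsInternal fun i => (𝒱 i).map N.mkQ := by
  refine isInternal_of_projections (fun i => N.mapQ N (componentProj 𝒱 i) (componentProj_mem hN i))
    ?_ ?_ ?_
  · rintro i _ ⟨v, hv, rfl⟩
    rw [Submodule.mkQ_apply, Submodule.mapQ_apply, componentProj_same i v hv]
  · rintro i j hij _ ⟨v, hv, rfl⟩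
    rw [Submodule.mkQ_apply, Submodule.mapQ_apply, componentProj_ne i j hij v hv,
      Submodule.Quotient.mk_zero]
  · rw [← Submodule.map_iSup, (Decomposition.isInternal 𝒱).submodule_iSup_eq_top,
      Submodule.map_top, Submodule.range_mkQ]

theorem decompose_map {F : Type*} [FunLike F V W] [AddMonoidHomClass F V W] (f : F) {g : I → J}
    (hg : Function.Injective g) (hf : ∀ i, ∀ v ∈ 𝒱 i, f v ∈ 𝒲 (g i)) (i : I) (v : V) :
    (decompose 𝒲 (f v) (g i) : W) = f (decompose 𝒱 v i) := by
  induction v using Decomposition.inductionOn 𝒱 with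
  | zero => simp
  | add v w hv hw => simp [hv, hw]
  | @homogeneous j v =>
    by_cases hji : j = i
    · subst hji
      rw [decompose_coe, of_eq_same, decompose_of_mem_same 𝒲 (hf j v v.2)]
    · rw [decompose_of_mem_ne 𝒲 (hf j v v.2) (hg.ne hji), decompose_of_mem_ne 𝒱 v.2 hji, map_zero]

theorem le_of_inf_le {N P : Submodule Φ V} (hN : N.IsHomogeneous 𝒱) (h : ∀ i, N ⊓ 𝒱 i ≤ P) :
    N ≤ P := fun _ hv => iSup_le h (mem_iSup_inf 𝒱 hN hv)

theorem isHomogeneous_comap {N : Submodule Φ W} (hN : N.IsHomogeneous 𝒲) (f : V →ₗ[Φ] W)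
    {g : I → J} (hg : Function.Injective g) (hf : ∀ i, ∀ v ∈ 𝒱 i, f v ∈ 𝒲 (g i)) :
    (N.comap f).IsHomogeneous 𝒱 := fun i v hv => by
  rw [Submodule.mem_comap, ← decompose_map f hg hf]
  exact hN (g i) hv

theorem isHomogeneous_range {f : V →ₗ[Φ] W} {g : I → J} (hg : Function.Bijective g)
    (hf : ∀ i, ∀ v ∈ 𝒱 i, f v ∈ 𝒲 (g i)) : (LinearMap.range f).IsHomogeneous 𝒲 := by
  rintro j _ ⟨v, rfl⟩
  obtain ⟨i, rfl⟩ := hg.2 j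
  exact ⟨decompose 𝒱 v i, (decompose_map f hg.1 hf i v).symm⟩

variable (𝒱) in
/-- The smallest homogeneous submodule that contains `N`. -/
def homogeneousHull (N : Submodule Φ V) : Submodule Φ V := ⨆ i, N.map (componentProj 𝒱 i)

theorem componentProj_mem_homogeneousHull {N : Submodule Φ V} (i : I) {v : V} (hv : v ∈ N) :
    componentProj 𝒱 i v ∈ homogeneousHull 𝒱 N := Submodule.mem_iSup_of_mem i ⟨v, hv, rfl⟩

theorem homogeneousHull_le_iff {N P : Submodule Φ V} :
    homogeneousHull 𝒱 N ≤ P ↔ ∀ i, ∀ v ∈ N, componentProj 𝒱 i v ∈ P :=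
  iSup_le_iff.trans (forall_congr' fun _ => Submodule.map_le_iff_le_comap)

theorem le_homogeneousHull (N : Submodule Φ V) : N ≤ homogeneousHull 𝒱 N := fun v hv => by
  classical
  rw [← sum_support_decompose 𝒱 v]
  exact sum_mem fun i _ => componentProj_mem_homogeneousHull i hv

theorem isHomogeneous_homogeneousHull (N : Submodule Φ V) :
    (homogeneousHull 𝒱 N).IsHomogeneous 𝒱 := fun i =>
  homogeneousHull_le_iff (P := (homogeneousHull 𝒱 N).comap (componentProj 𝒱 i)).2 fun j v hv => by
    rw [Submodule.mem_comap]
    by_cases hji : j = i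
    · subst hji
      rw [componentProj_same j (componentProj 𝒱 j v) (decompose 𝒱 v j).2]
      exact componentProj_mem_homogeneousHull j hv
    · rw [componentProj_ne j i hji (componentProj 𝒱 j v) (decompose 𝒱 v j).2]
      exact zero_mem _

theorem homogeneousHull_le_comap {N : Submodule Φ V} {f : V →ₗ[Φ] V} {g : I → I}
    (hg : Function.Injective g) (hf : ∀ i, ∀ v ∈ 𝒱 i, f v ∈ 𝒱 (g i)) (hN : N ≤ N.comap f) :
    homogeneousHull 𝒱 N ≤ (homogeneousHull 𝒱 N).comap f :=
  homogeneousHull_le_iff.2 fun i v hv => by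
    rw [Submodule.mem_comap]
    exact decompose_map f hg hf i v ▸ componentProj_mem_homogeneousHull (g i) (hN hv)

end Homogeneous

/-! ### Centers and derived algebras of graded Lie algebras -/

section GradedLie

open DirectSum

variable {Φ L M G : Type*} [CommRing Φ] [LieRing L] [LieAlgebra Φ L] [LieRing M] [LieAlgebra Φ M]

theorem mem_center_iff_forall_lie_eq_zero {z : L} :
    z ∈ LieAlgebra.center Φ L ↔ ∀ x : L, ⁅z, x⁆ = 0 :=
  (LieModule.mem_maxTrivSubmodule Φ L L z).trans <|
    forall_congr' fun x => by rw [← lie_skew, neg_eq_zero]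

theorem mem_center_derived_of_mem_center {z : Derived Φ L}
    (hz : (z : L) ∈ LieAlgebra.center Φ L) : z ∈ LieAlgebra.center Φ (Derived Φ L) :=
  mem_center_iff_forall_lie_eq_zero.2 fun x =>
    Subtype.ext (mem_center_iff_forall_lie_eq_zero.1 hz x)

theorem lie_mem_derived (x y : L) : ⁅x, y⁆ ∈ Derived Φ L :=
  LieSubmodule.lie_mem_lie (LieSubmodule.mem_top x) (LieSubmodule.mem_top y)

theorem modCenter_surjective : Function.Surjective (modCenter Φ L) :=
  (LieAlgebra.center Φ L).toSubmodule.mkQ_surjective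

theorem modCenter_eq_zero_iff {x : L} : modCenter Φ L x = 0 ↔ x ∈ LieAlgebra.center Φ L :=
  Submodule.Quotient.mk_eq_zero _

theorem derivedMap_injective {f : L →ₗ⁅Φ⁆ M} (hf : Function.Injective f) :
    Function.Injective (derivedMap f) := fun _ _ h => Subtype.ext (hf (congrArg Subtype.val h))

/-- The elements `m` of `M` with `[N, m] ⊆ L`, where `L` is mapped into `M` by `f`. -/
def absorbed (f : L →ₗ⁅Φ⁆ M) (N : LieIdeal Φ L) : Submodule Φ M where
  carrier := {m | ∀ x ∈ N, ⁅f x, m⁆ ∈ f.range}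
  add_mem' hm hm' x hx := by rw [lie_add]; exact add_mem (hm x hx) (hm' x hx)
  zero_mem' x _ := by rw [lie_zero]; exact zero_mem _
  smul_mem' c m hm x hx := by rw [lie_smul]; exact SMulMemClass.smul_mem c (hm x hx)

section Absorbed

variable {f : L →ₗ⁅Φ⁆ M} {N : LieIdeal Φ L}

theorem lie_mem_absorbed (l : L) {m : M} (hm : m ∈ absorbed f N) : ⁅f l, m⁆ ∈ absorbed f N := by
  intro x hx
  rw [leibniz_lie, ← LieHom.map_lie]
  exact add_mem (hm _ (lie_mem_left Φ L N x l hx)) (f.range.lie_mem ⟨l, rfl⟩ (hm x hx))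

theorem adSpan_le_absorbed {q : M} (hq : q ∈ absorbed f N) : adSpan f q ≤ absorbed f N := by
  refine Submodule.span_le.2 ?_
  rintro _ ⟨l, rfl⟩
  induction l with
  | nil => exact hq
  | cons x l ih => exact lie_mem_absorbed x ih

theorem mem_absorbed_derivedMap {q : Derived Φ M} (hq : (q : M) ∈ absorbed f N) :
    q ∈ absorbed (derivedMap f) (⁅N, N⁆.comap (Derived Φ L).incl) := by
  suffices h : ⁅N, N⁆.toSubmodule ≤ ((Derived Φ L).toSubmodule.map (f : L →ₗ[Φ] M)).comap
      ((LieAlgebra.ad Φ M : M →ₗ[Φ] Module.End Φ M).flip (q : M) ∘ₗ (f : L →ₗ[Φ] M)) by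
    intro x hx
    obtain ⟨w, hw, hwx⟩ := h hx
    exact ⟨⟨w, hw⟩, Subtype.ext hwx⟩
  rw [LieSubmodule.lieIdeal_oper_eq_linear_span', Submodule.span_le]
  rintro _ ⟨x, hx, y, hy, rfl⟩
  obtain ⟨a, ha⟩ := hq x hx
  obtain ⟨b, hb⟩ := hq y hy
  refine ⟨⁅x, b⁆ - ⁅y, a⁆, sub_mem (lie_mem_derived x b) (lie_mem_derived y a), ?_⟩
  change f (⁅x, b⁆ - ⁅y, a⁆) = ⁅f ⁅x, y⁆, (q : M)⁆
  rw [map_sub, LieHom.map_lie, LieHom.map_lie, LieHom.map_lie, lie_lie]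
  exact congrArg₂ (⁅f x, ·⁆ - ⁅f y, ·⁆) hb ha

end Absorbed

section Graded

variable [AddCommGroup G] {ℒ : G → Submodule Φ L} [SetLike.GradedBracket ℒ]

instance : SetLike.GradedBracket (derivedGrading ℒ) where
  bracket_mem _ _ _ _ hx hy := SetLike.GradedBracket.bracket_mem (ℒ := ℒ) hx hy

instance : SetLike.GradedBracket (modCenterGrading ℒ) where
  bracket_mem := by
    rintro i j _ _ ⟨x, hx, rfl⟩ ⟨y, hy, rfl⟩
    exact ⟨_, SetLike.GradedBracket.bracket_mem hx hy, LieHom.map_lie _ x y⟩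

variable [DecidableEq G] [Decomposition ℒ]

theorem decompose_lie {i j : G} (x : L) {y : L} (hy : y ∈ ℒ j) :
    (decompose ℒ ⁅x, y⁆ (i + j) : L) = ⁅(decompose ℒ x i : L), y⁆ :=
  decompose_map (AddMonoidHom.mk' (⁅·, y⁆) fun a b => add_lie a b y) (add_left_injective j)
    (fun _ _ hx => SetLike.GradedBracket.bracket_mem hx hy) i x

variable (ℒ)

theorem isHomogeneous_center : (LieAlgebra.center Φ L).toSubmodule.IsHomogeneous ℒ := by
  refine fun i z hz => mem_center_iff_forall_lie_eq_zero.2 fun y => ?_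
  induction y using Decomposition.inductionOn ℒ with
  | zero => exact lie_zero _
  | add y y' hy hy' => rw [lie_add, hy, hy', add_zero]
  | homogeneous y =>
    rw [← decompose_lie z y.2, mem_center_iff_forall_lie_eq_zero.1 hz]
    simp only [decompose_zero, DirectSum.zero_apply, ZeroMemClass.coe_zero]

variable {ℒ} in
theorem isHomogeneous_lie {N N' : LieIdeal Φ L} (hN : N.toSubmodule.IsHomogeneous ℒ)
    (hN' : N'.toSubmodule.IsHomogeneous ℒ) : ⁅N, N'⁆.toSubmodule.IsHomogeneous ℒ := by
  intro i z hz
  rw [LieSubmodule.lieIdeal_oper_eq_linear_span'] at hz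
  refine (Submodule.span_le (p := ⁅N, N'⁆.toSubmodule.comap (componentProj ℒ i))).2 ?_ hz
  rintro _ ⟨x, hx, y, hy, rfl⟩
  refine le_of_inf_le (P := ⁅N, N'⁆.toSubmodule.comap
    (componentProj ℒ i ∘ₗ (LieAlgebra.ad Φ L x : L →ₗ[Φ] L))) hN' (fun j y hy => ?_) hy
  have hcomp := decompose_lie (i := i - j) x hy.2
  rw [sub_add_cancel] at hcomp
  change (decompose ℒ ⁅x, y⁆ i : L) ∈ ⁅N, N'⁆
  rw [hcomp]
  exact LieSubmodule.lie_mem_lie (hN _ hx) hy.1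

theorem isHomogeneous_derived : (Derived Φ L).toSubmodule.IsHomogeneous ℒ :=
  isHomogeneous_lie (fun _ _ _ => trivial) fun _ _ _ => trivial

theorem isInternal_derivedGrading : IsInternal (derivedGrading ℒ) :=
  isInternal_comap_subtype (isHomogeneous_derived ℒ)

theorem isInternal_modCenterGrading : IsInternal (modCenterGrading ℒ) :=
  isInternal_map_mkQ (isHomogeneous_center ℒ)

end Graded

/-- The homomorphism `L / Z_L → M / Z_M` induced by a homomorphism `L → M` that maps `Z_L` into
`Z_M`. -/
def modCenterMap (f : L →ₗ⁅Φ⁆ M)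
    (hf : ∀ z ∈ LieAlgebra.center Φ L, f z ∈ LieAlgebra.center Φ M) :
    ModCenter Φ L →ₗ⁅Φ⁆ ModCenter Φ M where
  toLinearMap := Submodule.mapQ _ _ (f : L →ₗ[Φ] M) hf
  map_lie' {x y} := by
    obtain ⟨x, rfl⟩ := modCenter_surjective x
    obtain ⟨y, rfl⟩ := modCenter_surjective y
    exact congrArg (modCenter Φ M) (LieHom.map_lie f x y)

theorem modCenterMap_modCenter (f : L →ₗ⁅Φ⁆ M)
    (hf : ∀ z ∈ LieAlgebra.center Φ L, f z ∈ LieAlgebra.center Φ M) (x : L) :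
    modCenterMap f hf (modCenter Φ L x) = modCenter Φ M (f x) := rfl

theorem modCenterMap_injective {f : L →ₗ⁅Φ⁆ M} (hinj : Function.Injective f)
    (hf : ∀ z ∈ LieAlgebra.center Φ L, f z ∈ LieAlgebra.center Φ M) :
    Function.Injective (modCenterMap f hf) := by
  refine (injective_iff_map_eq_zero _).2 fun x hx => ?_
  obtain ⟨x, rfl⟩ := modCenter_surjective x
  rw [modCenterMap_modCenter, modCenter_eq_zero_iff, mem_center_iff_forall_lie_eq_zero] at hx
  exact modCenter_eq_zero_iff.2 <| mem_center_iff_forall_lie_eq_zero.2 fun y =>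
    hinj (by rw [LieHom.map_lie, hx, map_zero])

theorem modCenter_mem_absorbed {f : L →ₗ⁅Φ⁆ M}
    (hf : ∀ z ∈ LieAlgebra.center Φ L, f z ∈ LieAlgebra.center Φ M) {N : LieIdeal Φ L} {q : M}
    (hq : q ∈ absorbed f N) :
    modCenter Φ M q ∈ absorbed (modCenterMap f hf) (N.map (modCenter Φ L)) := by
  rintro _ hx
  obtain ⟨x, rfl⟩ := LieIdeal.mem_map_of_surjective modCenter_surjective hx
  obtain ⟨z, hz⟩ := hq x x.2
  exact ⟨modCenter Φ L z, congrArg (modCenter Φ M) hz⟩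

theorem exists_homogeneous_lie_notMem_center [DecidableEq G] {ℒ : G → Submodule Φ L}
    [Decomposition ℒ] (f : L →ₗ⁅Φ⁆ M) {N : LieIdeal Φ L} (hN : N.toSubmodule.IsHomogeneous ℒ)
    {p : M} {x : L} (hx : x ∈ N) (hp : ⁅f x, p⁆ ∉ LieAlgebra.center Φ M) :
    ∃ α, ∃ x ∈ ℒ α, x ∈ N ∧ ⁅f x, p⁆ ∉ LieAlgebra.center Φ M := by
  contrapose! hp
  exact le_of_inf_le (P := (LieAlgebra.center Φ M).toSubmodule.comap
    ((LieAlgebra.ad Φ M : M →ₗ[Φ] Module.End Φ M).flip p ∘ₗ (f : L →ₗ[Φ] M))) hN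
    (fun α x hx => hp α x hx.2 hx.1) hx

theorem isGradedAlgebraOfQuotients_modCenterMap [AddCommGroup G] [DecidableEq G]
    {ℒ : G → Submodule Φ L} {ℳ : G → Submodule Φ M} [Decomposition ℒ] [Decomposition ℳ]
    [SetLike.GradedBracket ℒ] [SetLike.GradedBracket ℳ] {f : L →ₗ⁅Φ⁆ M}
    (hf : ∀ z ∈ LieAlgebra.center Φ L, f z ∈ LieAlgebra.center Φ M)
    (hinj : Function.Injective f) (hmap : ∀ σ, ∀ x ∈ ℒ σ, f x ∈ ℳ σ)
    (habsorb : ∀ τ, ∀ q ∈ ℳ τ, ∃ N : LieIdeal Φ L, N.toSubmodule.IsHomogeneous ℒ ∧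
      q ∈ absorbed f N ∧ ∀ p, (∀ x ∈ N, ⁅f x, p⁆ ∈ LieAlgebra.center Φ M) →
        p ∈ LieAlgebra.center Φ M) :
    IsGradedAlgebraOfQuotients (modCenterMap f hf) (modCenterGrading ℒ)
      (modCenterGrading ℳ) where
  isInternal_sub := isInternal_modCenterGrading ℒ
  gradedBracket_sub := inferInstance
  isInternal := isInternal_modCenterGrading ℳ
  gradedBracket := inferInstance
  injective := modCenterMap_injective hinj hf
  map_mem σ := by
    rintro _ ⟨x, hx, rfl⟩
    exact ⟨f x, hmap σ x hx, rfl⟩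
  absorb := by
    rintro σ τ _ ⟨p, -, rfl⟩ hp _ ⟨q, hq, rfl⟩
    obtain ⟨N, hN, hqN, hcenter⟩ := habsorb τ q hq
    obtain ⟨x, hx, hxp⟩ : ∃ x ∈ N, ⁅f x, p⁆ ∉ LieAlgebra.center Φ M := by
      by_contra! h
      exact hp (modCenter_eq_zero_iff.2 (hcenter p h))
    obtain ⟨α, x, hxα, hx, hxp⟩ := exists_homogeneous_lie_notMem_center f hN hx hxp
    exact ⟨α, modCenter Φ L x, ⟨x, hxα, rfl⟩, mt modCenter_eq_zero_iff.1 hxp, fun y hy =>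
      adSpan_le_absorbed (modCenter_mem_absorbed hf hqN) hy _ (LieIdeal.mem_map hx)⟩

end GradedLie

/-! ### Skew elements of algebras of quotients -/

theorem mem_skewAdjoint_of_map_mem {R S F : Type*} [AddCommGroup R] [StarAddMonoid R]
    [AddCommGroup S] [StarAddMonoid S] [FunLike F R S] [AddMonoidHomClass F R S]
    [StarHomClass F R S] {f : F} (hf : Function.Injective f) {x : R}
    (hx : f x ∈ skewAdjoint S) : x ∈ skewAdjoint R :=
  hf <| (map_star f x).trans <| (skewAdjoint.mem_iff.1 hx).trans (map_neg f x).symm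

section Skew

open DirectSum

variable {Φ R S G : Type*} [CommRing Φ] [StarRing Φ] [TrivialStar Φ] [NonUnitalRing R] [StarRing R]
  [Module Φ R] [StarModule Φ R] [NonUnitalRing S] [StarRing S] [Module Φ S] [StarModule Φ S]

instance [AddCommGroup G] {ℛ : G → Submodule Φ R} [SetLike.GradedMul ℛ] :
    SetLike.GradedBracket (skewGrading ℛ) where
  bracket_mem i j x y hx hy := by
    have hyx : (y * x : R) ∈ ℛ (j + i) := SetLike.mul_mem_graded hy hx
    exact sub_mem (SetLike.mul_mem_graded (A := ℛ) hx hy) (add_comm j i ▸ hyx)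

theorem isHomogeneous_skewAdjoint [DecidableEq G] {ℛ : G → Submodule Φ R} [Decomposition ℛ]
    (hstar : ∀ σ, ∀ a ∈ ℛ σ, star a ∈ ℛ σ) : (skewAdjoint.submodule Φ R).IsHomogeneous ℛ := by
  intro i x hx
  change star (decompose ℛ x i : R) = -(decompose ℛ x i : R)
  rw [← starAddEquiv_apply, ← decompose_map starAddEquiv Function.injective_id hstar,
    starAddEquiv_apply, skewAdjoint.mem_iff.1 hx]
  exact map_neg (componentProj ℛ i) x

theorem isInternal_skewGrading [DecidableEq G] {ℛ : G → Submodule Φ R} [Decomposition ℛ]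
    (hstar : ∀ σ, ∀ a ∈ ℛ σ, star a ∈ ℛ σ) : IsInternal (skewGrading ℛ) :=
  isInternal_comap_subtype (isHomogeneous_skewAdjoint hstar)

variable [IsScalarTower Φ R R] [SMulCommClass Φ R R] [IsScalarTower Φ S S] [SMulCommClass Φ S S]

theorem mem_center_skew_iff {z : Skew Φ R} :
    z ∈ LieAlgebra.center Φ (Skew Φ R) ↔ ∀ k ∈ skewAdjoint R, Commute (z : R) k := by
  rw [mem_center_iff_forall_lie_eq_zero]
  exact ⟨fun h k hk => commute_iff_lie_eq.2 (congrArg Subtype.val (h ⟨k, hk⟩)),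
    fun h x => Subtype.ext (h x x.2).lie_eq⟩

theorem commute_lie_of_mem_center_derived_skew {z : Derived Φ (Skew Φ R)}
    (hz : z ∈ LieAlgebra.center Φ (Derived Φ (Skew Φ R))) {k l : R} (hk : k ∈ skewAdjoint R)
    (hl : l ∈ skewAdjoint R) : Commute ((z : Skew Φ R) : R) ⁅k, l⁆ :=
  commute_iff_lie_eq.2 <| congrArg (fun x : Derived Φ (Skew Φ R) => ((x : Skew Φ R) : R)) <|
    mem_center_iff_forall_lie_eq_zero.1 hz
      ⟨⁅(⟨k, hk⟩ : Skew Φ R), (⟨l, hl⟩ : Skew Φ R)⁆, lie_mem_derived _ _⟩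

theorem coe_mem_center_skew_of_mem_center_derived [IsSemiprimeAlg R]
    (h2 : ∀ a : R, a + a = 0 → a = 0) {z : Derived Φ (Skew Φ R)}
    (hz : z ∈ LieAlgebra.center Φ (Derived Φ (Skew Φ R))) :
    (z : Skew Φ R) ∈ LieAlgebra.center Φ (Skew Φ R) :=
  mem_center_skew_iff.2 fun _ hk =>
    commute_skewAdjoint_of_commute_lie_derived h2 (z : Skew Φ R).2 (fun a ha b hb c _ => by
      rw [(commute_lie_of_mem_center_derived_skew hz ha hb).lie_eq]
      exact Commute.zero_left c) hk

theorem skewMap_injective {ι : R →⋆ₙₐ[Φ] S} (hι : Function.Injective ι) :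
    Function.Injective (skewMap ι) := fun _ _ h => Subtype.ext (hι (congrArg Subtype.val h))

theorem mem_range_skewMap {ι : R →⋆ₙₐ[Φ] S} (hι : Function.Injective ι) {s : Skew Φ S}
    (hs : (s : S) ∈ LinearMap.range (ι : R →ₗ[Φ] S)) : s ∈ (skewMap ι).range := by
  obtain ⟨⟨_, hs'⟩, a, rfl⟩ := s, hs
  exact ⟨⟨a, mem_skewAdjoint_of_map_mem hι hs'⟩, rfl⟩

end Skew

namespace Martindale

open DirectSum

variable {Φ A R G : Type*} [CommRing Φ] [NonUnitalRing A] [Module Φ A] [NonUnitalRing R]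
  [Module Φ R] [IsScalarTower Φ A A] [SMulCommClass Φ A A] [IsScalarTower Φ R R]
  [SMulCommClass Φ R R]

section Homogeneous

variable [AddCommGroup G] [DecidableEq G] {𝒜 : G → Submodule Φ A} [Decomposition 𝒜]
  [SetLike.GradedMul 𝒜]

theorem IsDenseIdeal.homogeneousHull {I : Submodule Φ A} (hI : IsDenseIdeal I) :
    IsDenseIdeal (homogeneousHull 𝒜 I) := by
  refine hI.of_le (le_homogeneousHull I) (fun a x hx => ?_) fun a x hx => ?_
  all_goals induction a using Decomposition.inductionOn 𝒜 with
  | zero => simp only [zero_mul, mul_zero, zero_mem]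
  | add a b ha hb => simpa only [add_mul, mul_add] using add_mem ha hb
  | @homogeneous j a => ?_
  · exact homogeneousHull_le_comap (f := LinearMap.mulLeft Φ (a : A)) (add_right_injective j)
      (fun _ _ hv => SetLike.mul_mem_graded a.2 hv) (fun v hv => hI.mul_left a v hv) hx
  · exact homogeneousHull_le_comap (f := LinearMap.mulRight Φ (a : A)) (add_left_injective j)
      (fun _ _ hv => SetLike.mul_mem_graded hv a.2) (fun v hv => hI.mul_right a v hv) hx

variable [StarRing A] [StarRing R] {ℛ : G → Submodule Φ R} [Decomposition ℛ]
  [SetLike.GradedMul ℛ] [IsSemiprimeAlg A] {ι : A →⋆ₙₐ[Φ] R}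

theorem IsSymmetricQuotientMap.exists_isHomogeneous (hι : IsSymmetricQuotientMap ι)
    (hdeg : ∀ σ, ∀ a ∈ 𝒜 σ, ι a ∈ ℛ σ) {τ : G} {q : R} (hq : q ∈ ℛ τ) :
    ∃ I : Submodule Φ A, IsDenseIdeal I ∧ I.IsHomogeneous 𝒜 ∧ ∀ a ∈ I,
      q * ι a ∈ LinearMap.range (ι : A →ₗ[Φ] R) ∧ ι a * q ∈ LinearMap.range (ι : A →ₗ[Φ] R) := by
  obtain ⟨K, hK, -, hKq⟩ := hι.exists_mul_mem q ⊤ isDenseIdeal_top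
  let B : Submodule Φ R := LinearMap.range (ι : A →ₗ[Φ] R)
  have hB : B.IsHomogeneous ℛ := isHomogeneous_range Function.bijective_id hdeg
  have hl : (B.comap (LinearMap.mulLeft Φ q ∘ₗ (ι : A →ₗ[Φ] R))).IsHomogeneous 𝒜 :=
    isHomogeneous_comap hB _ (add_right_injective τ) fun σ a ha =>
      SetLike.mul_mem_graded hq (hdeg σ a ha)
  have hr : (B.comap (LinearMap.mulRight Φ q ∘ₗ (ι : A →ₗ[Φ] R))).IsHomogeneous 𝒜 :=
    isHomogeneous_comap hB _ (add_left_injective τ) fun σ a ha =>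
      SetLike.mul_mem_graded (hdeg σ a ha) hq
  refine ⟨_, hK.homogeneousHull, isHomogeneous_homogeneousHull (𝒱 := 𝒜) K, fun a ha =>
    ⟨homogeneousHull_le_iff.2 (fun i v hv => hl i ?_) ha,
      homogeneousHull_le_iff.2 (fun i v hv => hr i ?_) ha⟩⟩
  · exact (hKq v hv).1.imp fun _ => And.right
  · exact (hKq v hv).2.imp fun _ => And.right

end Homogeneous

variable [StarRing Φ] [TrivialStar Φ] [StarRing A] [StarModule Φ A] [StarRing R] [StarModule Φ R]

section SkewIdeal

variable {I : Submodule Φ A} (hI : IsDenseIdeal I)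

/-- The Lie ideal `K_A ∩ I` of `K_A` for an essential ideal `I` of `A`. -/
def skewIdeal : LieIdeal Φ (Skew Φ A) where
  __ := I.comap (skewAdjoint.submodule Φ A).subtype
  lie_mem {x y} hy := sub_mem (hI.mul_left x y hy) (hI.mul_right x y hy)

theorem mem_absorbed_skewIdeal {ι : A →⋆ₙₐ[Φ] R} (hι : Function.Injective ι) {q : Skew Φ R}
    (hq : ∀ a ∈ I, (q : R) * ι a ∈ LinearMap.range (ι : A →ₗ[Φ] R) ∧
      ι a * q ∈ LinearMap.range (ι : A →ₗ[Φ] R)) : q ∈ absorbed (skewMap ι) (skewIdeal hI) :=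
  fun x hx => mem_range_skewMap hι (sub_mem (hq x hx).2 (hq x hx).1)

theorem isHomogeneous_skewIdeal [DecidableEq G] {𝒜 : G → Submodule Φ A} [Decomposition 𝒜]
    [Decomposition (skewGrading 𝒜)] (hhom : I.IsHomogeneous 𝒜) :
    (skewIdeal hI).toSubmodule.IsHomogeneous (skewGrading 𝒜) :=
  isHomogeneous_comap hhom (skewAdjoint.submodule Φ A).subtype Function.injective_id
    fun _ _ hx => hx

end SkewIdeal

namespace IsSymmetricQuotientMap

variable {ι : A →⋆ₙₐ[Φ] R} (hι : IsSymmetricQuotientMap ι) [IsSemiprimeAlg A]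
  (h2 : ∀ a : A, a + a = 0 → a = 0)
include hι h2

section Center

variable {I : Submodule Φ A} (hI : IsDenseIdeal I)

theorem mem_center_skew_of_lie_skewIdeal_mem_center {p : Skew Φ R}
    (h : ∀ x ∈ skewIdeal hI, ⁅skewMap ι x, p⁆ ∈ LieAlgebra.center Φ (Skew Φ R)) :
    p ∈ LieAlgebra.center Φ (Skew Φ R) := by
  obtain ⟨S, hS, hSI⟩ := hI.exists_starSubalgebra_le
  refine mem_center_skew_iff.2 fun q hq => hι.isDenseFamily.commute_skewAdjoint_of_commute_lie
    (hι.eq_zero_of_add_self h2) ⟨S, hS, rfl⟩ p.2 ?_ hq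
  rintro _ ⟨x, hx, rfl⟩ hx' k hk
  rw [Ring.lie_def, ← neg_sub]
  exact (mem_center_skew_iff.1
    (h ⟨x, mem_skewAdjoint_of_map_mem hι.injective hx'⟩ (hSI hx)) k hk).neg_left

theorem mem_center_derived_skew_of_lie_skewIdeal_mem_center {p : Derived Φ (Skew Φ R)}
    (h : ∀ x ∈ ⁅skewIdeal hI, skewIdeal hI⁆.comap (Derived Φ (Skew Φ A)).incl,
      ⁅derivedMap (skewMap ι) x, p⁆ ∈ LieAlgebra.center Φ (Derived Φ (Skew Φ R))) :
    p ∈ LieAlgebra.center Φ (Derived Φ (Skew Φ R)) := by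
  obtain ⟨S, hS, hSI⟩ := hI.exists_starSubalgebra_le
  refine mem_center_derived_of_mem_center <| mem_center_skew_iff.2 fun q hq =>
    hι.isDenseFamily.commute_skewAdjoint_of_commute_lie_derived
      (hι.eq_zero_of_add_self h2) ⟨S, hS, rfl⟩ (p : Skew Φ R).2 ?_ hq
  rintro _ ⟨x, hx, rfl⟩ hx' _ ⟨y, hy, rfl⟩ hy' k hk l hl
  let x' : Skew Φ A := ⟨x, mem_skewAdjoint_of_map_mem hι.injective hx'⟩
  let y' : Skew Φ A := ⟨y, mem_skewAdjoint_of_map_mem hι.injective hy'⟩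
  have hxy : ⁅x', y'⁆ ∈ ⁅skewIdeal hI, skewIdeal hI⁆ := LieSubmodule.lie_mem_lie (hSI hx) (hSI hy)
  have key := commute_lie_of_mem_center_derived_skew
    (h ⟨⁅x', y'⁆, lie_mem_derived x' y'⟩ hxy) hk hl
  change Commute ((⁅(p : Skew Φ R), ⁅skewMap ι x', skewMap ι y'⁆⁆ : Skew Φ R) : R) ⁅k, l⁆
  rw [← LieHom.map_lie, ← lie_skew]
  exact key.neg_left

end Center

theorem map_mem_center_skew {z : Skew Φ A} (hz : z ∈ LieAlgebra.center Φ (Skew Φ A)) :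
    skewMap ι z ∈ LieAlgebra.center Φ (Skew Φ R) :=
  hι.mem_center_skew_of_lie_skewIdeal_mem_center h2 isDenseIdeal_top fun x _ => by
    rw [← LieHom.map_lie, ← lie_skew, mem_center_iff_forall_lie_eq_zero.1 hz, neg_zero, map_zero]
    exact zero_mem _

theorem map_mem_center_derived_skew {z : Derived Φ (Skew Φ A)}
    (hz : z ∈ LieAlgebra.center Φ (Derived Φ (Skew Φ A))) :
    derivedMap (skewMap ι) z ∈ LieAlgebra.center Φ (Derived Φ (Skew Φ R)) :=
  mem_center_derived_of_mem_center <|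
    hι.map_mem_center_skew h2 (coe_mem_center_skew_of_mem_center_derived h2 hz)

section Graded

variable [AddCommGroup G] [DecidableEq G] {𝒜 : G → Submodule Φ A} [Decomposition 𝒜]
  [SetLike.GradedMul 𝒜] {ℛ : G → Submodule Φ R} [Decomposition ℛ] [SetLike.GradedMul ℛ]
  (hstar𝒜 : ∀ σ, ∀ a ∈ 𝒜 σ, star a ∈ 𝒜 σ) (hstarℛ : ∀ σ, ∀ q ∈ ℛ σ, star q ∈ ℛ σ)
  (hdeg : ∀ σ, ∀ a ∈ 𝒜 σ, ι a ∈ ℛ σ)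

include hstar𝒜 hstarℛ hdeg

theorem isGradedAlgebraOfQuotients_skew :
    IsGradedAlgebraOfQuotients (modCenterMap (skewMap ι) fun _ => hι.map_mem_center_skew h2)
      (modCenterGrading (skewGrading 𝒜)) (modCenterGrading (skewGrading ℛ)) := by
  let := (isInternal_skewGrading hstar𝒜).chooseDecomposition
  let := (isInternal_skewGrading hstarℛ).chooseDecomposition
  refine isGradedAlgebraOfQuotients_modCenterMap _ (skewMap_injective hι.injective)
    (fun σ x hx => hdeg σ x hx) fun τ q hq => ?_
  obtain ⟨I, hI, hhom, hIq⟩ := hι.exists_isHomogeneous hdeg hq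
  exact ⟨skewIdeal hI, isHomogeneous_skewIdeal hI hhom,
    mem_absorbed_skewIdeal hI hι.injective hIq,
    fun p => hι.mem_center_skew_of_lie_skewIdeal_mem_center h2 hI⟩

theorem isGradedAlgebraOfQuotients_derived_skew :
    IsGradedAlgebraOfQuotients
      (modCenterMap (derivedMap (skewMap ι)) fun _ => hι.map_mem_center_derived_skew h2)
      (modCenterGrading (derivedGrading (skewGrading 𝒜)))
      (modCenterGrading (derivedGrading (skewGrading ℛ))) := by
  let := (isInternal_skewGrading hstar𝒜).chooseDecomposition
  let := (isInternal_skewGrading hstarℛ).chooseDecomposition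
  let := (isInternal_derivedGrading (skewGrading 𝒜)).chooseDecomposition
  let := (isInternal_derivedGrading (skewGrading ℛ)).chooseDecomposition
  refine isGradedAlgebraOfQuotients_modCenterMap _
    (derivedMap_injective (skewMap_injective hι.injective)) (fun σ x hx => hdeg σ _ hx)
    fun τ q hq => ?_
  obtain ⟨I, hI, hhom, hIq⟩ := hι.exists_isHomogeneous hdeg hq
  have hN := isHomogeneous_skewIdeal hI hhom
  exact ⟨_, isHomogeneous_comap (isHomogeneous_lie hN hN)
      (Derived Φ (Skew Φ A)).toSubmodule.subtype Function.injective_id fun _ _ hx => hx,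
    mem_absorbed_derivedMap (mem_absorbed_skewIdeal hI hι.injective hIq),
    fun p => hι.mem_center_derived_skew_of_lie_skewIdeal_mem_center h2 hI⟩

end Graded

end IsSymmetricQuotientMap

end Martindale

theorem mainTheorem4 {Φ A G : Type*} [CommRing Φ] [StarRing Φ] [TrivialStar Φ]
    [AddCommGroup G] [DecidableEq G]
    -- `A` is a semiprime algebra without 2-torsion, with an involution
    [NonUnitalRing A] [Module Φ A] [IsScalarTower Φ A A] [SMulCommClass Φ A A]
    [StarRing A] [StarModule Φ A] [IsSemiprimeAlg A]
    (h2 : ∀ a : A, a + a = 0 → a = 0)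
    -- `A` is graded and the involution preserves the grading
    (𝒜 : G → Submodule Φ A) (h𝒜 : DirectSum.IsInternal 𝒜) [SetLike.GradedMul 𝒜]
    (hstar𝒜 : ∀ σ, ∀ a ∈ 𝒜 σ, star a ∈ 𝒜 σ)
    -- `Q` is a `*`-subalgebra of `Q_s(A)` that contains `A`
    (Q : NonUnitalStarSubalgebra Φ (Martindale.Qs Φ A)) (hAQ : ∀ a, Martindale.Qs.incl Φ A a ∈ Q)
    -- `Q` is graded, `A` is a graded subalgebra of it, and the involution preserves the grading
    (𝒬 : G → Submodule Φ Q) (h𝒬 : DirectSum.IsInternal 𝒬) [SetLike.GradedMul 𝒬]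
    (hstar𝒬 : ∀ σ, ∀ q ∈ 𝒬 σ, star q ∈ 𝒬 σ)
    (hle : ∀ σ, ∀ a ∈ 𝒜 σ, (⟨Martindale.Qs.incl Φ A a, hAQ a⟩ : Q) ∈ 𝒬 σ) :
    (∃ φ : ModCenter Φ (Skew Φ A) →ₗ⁅Φ⁆ ModCenter Φ (Skew Φ Q),
      (∀ x, φ (modCenter Φ _ x) = modCenter Φ _ (Martindale.Qs.skewIncl Q hAQ x)) ∧
      IsGradedAlgebraOfQuotients φ (modCenterGrading (skewGrading 𝒜))
        (modCenterGrading (skewGrading 𝒬))) ∧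
    (∃ φ : ModCenter Φ (Derived Φ (Skew Φ A)) →ₗ⁅Φ⁆ ModCenter Φ (Derived Φ (Skew Φ Q)),
      (∀ x, φ (modCenter Φ _ x) = modCenter Φ _ (derivedMap (Martindale.Qs.skewIncl Q hAQ) x)) ∧
      IsGradedAlgebraOfQuotients φ (modCenterGrading (derivedGrading (skewGrading 𝒜)))
        (modCenterGrading (derivedGrading (skewGrading 𝒬)))) := by
  let := h𝒜.chooseDecomposition
  let := h𝒬.chooseDecomposition
  have hι := Martindale.Qs.isSymmetricQuotientMap_incl.codRestrict Q hAQ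
  exact ⟨⟨_, fun _ => rfl, hι.isGradedAlgebraOfQuotients_skew h2 hstar𝒜 hstar𝒬 hle⟩,
    ⟨_, fun _ => rfl, hι.isGradedAlgebraOfQuotients_derived_skew h2 hstar𝒜 hstar𝒬 hle⟩⟩
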